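/- Let $\mathcal{B}$ be a unitary fusion category over $\mathbb{C}$, with dagger $\dagger$ and canonical (spherical) trace $\mathrm{Tr}$, and let $(\mathcal{A}, m, \eta)$ be an algebra (associative, unital) in $\mathcal{B}$ which is connected, i.e. $\dim \mathrm{Hom}(\mathbf{1}, \mathcal{A}) = 1$. For objects $a, b$ of $\mathcal{B}$ let $$M_{a,b} : \mathrm{Hom}(a, \mathcal{A}) \otimes \mathrm{Hom}(b, \mathcal{A}) \to \mathrm{Hom}(a \otimes b, \mathcal{A}), \qquad M_{a,b}(f \otimes g) = m \circ (f \otimes g).$$ For an automorphism $T$ of the object $\mathcal{A}$, give each space $\mathrm{Hom}(c, \mathcal{A})$ the inner product $\langle f, g\rangle_T = \mathrm{Tr}_c\big((T f)^\dagger (T g)\big)$ (for $T = \mathrm{id}$ this is the trace inner product; $T$ encodes a normalization of the hom-spaces into $\mathcal{A}$), and give $\mathrm{Hom}(a, \mathcal{A}) \otimes \mathrm{Hom}(b, \mathcal{A})$ the tensor product inner product. Then $\mathcal{A}$ is separable, i.e. $m$ has a section $\mathcal{A} \to \mathcal{A} \otimes \mathcal{A}$ which is a morphism of $(\mathcal{A},\mathcal{A})$-bimodules,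 if and only if there is an automorphism $T$ of the object $\mathcal{A}$ such that, for all objects $a, b$ of $\mathcal{B}$, the map $M_{a,b}$ is an injective partial isometry with respect to the inner products $\langle\cdot,\cdot\rangle_T$. In particular, if $\mathcal{A}$ is separable then every $M_{a,b}$ is injective. -/

import Mathlib

open CategoryTheory MonoidalCategory
open scoped TensorProduct ComplexConjugate

universe v u

section Fusion

attribute [local instance] Abelian.hasFiniteBiproducts

/-- A fusion category over `ℂ`: a rigid semisimple `ℂ`-linear monoidal abelian category with
finite-dimensional hom-spaces, finitely many isomorphism classes of simple objects, and a simple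
tensor unit. -/
class IsFusionCategory (B : Type u) [Category.{v} B] [MonoidalCategory B] [Abelian B]
    [Linear ℂ B] [MonoidalPreadditive B] [MonoidalLinear ℂ B] [RigidCategory B] : Prop where
  finite_hom : ∀ X Y : B, FiniteDimensional ℂ (X ⟶ Y)
  simple_unit : Simple (𝟙_ B)
  finite_simples : ∃ (n : ℕ) (S : Fin n → B), ∀ X : B, Simple X → ∃ i, Nonempty (X ≅ S i)
  semisimple : ∀ X : B, ∃ (n : ℕ) (S : Fin n → B),
    (∀ i, Simple (S i)) ∧ Nonempty (X ≅ ⨁ S)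

end Fusion

/-- A unitary structure on a `ℂ`-linear monoidal category: a conjugate-linear positive dagger
operation which is compatible with the tensor product and for which the structure isomorphisms of
the monoidal category are unitary. -/
class UnitaryStructure (B : Type u) [Category.{v} B] [MonoidalCategory B] [Abelian B]
    [Linear ℂ B] where
  dag : ∀ {X Y : B}, (X ⟶ Y) → (Y ⟶ X)
  dag_dag : ∀ {X Y : B} (f : X ⟶ Y), dag (dag f) = f
  dag_comp : ∀ {X Y Z : B} (f : X ⟶ Y) (g : Y ⟶ Z), dag (f ≫ g) = dag g ≫ dag f
  dag_add : ∀ {X Y : B} (f g : X ⟶ Y), dag (f + g) = dag f + dag g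
  dag_smul : ∀ {X Y : B} (c : ℂ) (f : X ⟶ Y), dag (c • f) = conj c • dag f
  /-- The dagger is definite. -/
  dag_definite : ∀ {X Y : B} (f : X ⟶ Y), f ≫ dag f = 0 → f = 0
  /-- The endomorphism `f† ∘ f` of `X` is a positive element of the `*`-algebra `End X`. -/
  dag_positive : ∀ {X Y : B} (f : X ⟶ Y), ∃ g : X ⟶ X, f ≫ dag f = g ≫ dag g
  dag_tensor : ∀ {X Y X' Y' : B} (f : X ⟶ Y) (g : X' ⟶ Y'), dag (f ⊗ₘ g) = dag f ⊗ₘ dag g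
  dag_associator : ∀ X Y Z : B, dag (α_ X Y Z).hom = (α_ X Y Z).inv
  dag_leftUnitor : ∀ X : B, dag (λ_ X).hom = (λ_ X).inv
  dag_rightUnitor : ∀ X : B, dag (ρ_ X).hom = (ρ_ X).inv

namespace UnitaryFusion

open UnitaryStructure

section Trace

variable {B : Type u} [Category.{v} B] [MonoidalCategory B] [Abelian B] [Linear ℂ B]
  [MonoidalPreadditive B] [MonoidalLinear ℂ B] [RigidCategory B]

/-- Since the unit is simple, `c ↦ c • 𝟙` is a bijection from `ℂ` to `End 𝟙`. -/
lemma unit_scalar_bijective [IsFusionCategory B] :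
    Function.Bijective (LinearMap.toSpanSingleton ℂ (𝟙_ B ⟶ 𝟙_ B) (𝟙 (𝟙_ B))) := by
  have : Simple (𝟙_ B) := IsFusionCategory.simple_unit
  have : FiniteDimensional ℂ (𝟙_ B ⟶ 𝟙_ B) := IsFusionCategory.finite_hom _ _
  have h1 : Module.finrank ℂ (𝟙_ B ⟶ 𝟙_ B) = 1 := finrank_endomorphism_simple_eq_one ℂ (𝟙_ B)
  refine ⟨?_, ?_⟩
  · intro c c' h
    exact smul_left_injective ℂ (id_nonzero (𝟙_ B)) (by simpa using h)
  · intro f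
    obtain ⟨c, hc⟩ := (finrank_eq_one_iff_of_nonzero' (𝟙 (𝟙_ B)) (id_nonzero (𝟙_ B))).1 h1 f
    exact ⟨c, by simpa using hc⟩

/-- The number `c` attached to the endomorphism `c • 𝟙` of the tensor unit. -/
noncomputable def unitScalar (B : Type u) [Category.{v} B] [MonoidalCategory B] [Abelian B]
    [Linear ℂ B] [MonoidalPreadditive B] [MonoidalLinear ℂ B] [RigidCategory B]
    [IsFusionCategory B] : (𝟙_ B ⟶ 𝟙_ B) →ₗ[ℂ] ℂ :=
  (LinearEquiv.ofBijective _ (unit_scalar_bijective (B := B))).symm.toLinearMap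

/-- A standard (balanced) dual of `X`: a dual object whose evaluation and coevaluation are such
that the left trace `ev ∘ (id ⊗ f) ∘ ev†` and the right trace `coev† ∘ (f ⊗ id) ∘ coev` agree for
every endomorphism `f` of `X`. -/
structure StandardDual [UnitaryStructure B] (X : B) where
  dual : B
  pairing : ExactPairing X dual
  balanced : ∀ f : X ⟶ X,
    dag pairing.evaluation' ≫ (dual ◁ f) ≫ pairing.evaluation' =
      pairing.coevaluation' ≫ (f ▷ dual) ≫ dag pairing.coevaluation'

open Classical in
/-- The canonical (spherical, unnormalized) trace `End X → ℂ` of a unitary fusion category. Every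
object has a standard dual, and the trace does not depend on its choice. -/
noncomputable def trace [IsFusionCategory B] [UnitaryStructure B] (X : B) : (X ⟶ X) →ₗ[ℂ] ℂ :=
  if h : Nonempty (StandardDual X) then
    unitScalar B ∘ₗ
      { toFun := fun f =>
          h.some.pairing.coevaluation' ≫ (f ▷ h.some.dual) ≫ dag h.some.pairing.coevaluation'
        map_add' := fun f g => by simp
        map_smul' := fun c f => by simp }
  else 0

/-- The inner product `⟨f, g⟩ = Tr_c ((T ∘ f)† ∘ (T ∘ g))` on `Hom(c, A)`, conjugate-linear in the
first argument, for an automorphism `T` of the object `A`. For `T = id` it is the usual trace inner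
product on `Hom(c, A)`; in general it is the one that `Hom(c, A)` gets from the Hermitian metric
`T† ∘ T` on the object `A`. -/
noncomputable def homForm [IsFusionCategory B] [UnitaryStructure B] {A : B} (T : A ≅ A) (c : B) :
    (c ⟶ A) →ₗ⋆[ℂ] (c ⟶ A) →ₗ[ℂ] ℂ :=
  LinearMap.mk₂'ₛₗ (starRingEnd ℂ) (RingHom.id ℂ)
    (fun f g => trace c ((g ≫ T.hom) ≫ dag (f ≫ T.hom)))
    (fun f f' g => by simp [dag_add, dag_comp])
    (fun a f g => by simp [dag_smul, dag_comp])
    (fun f g g' => by simp)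
    (fun a f g => by simp)

end Trace

section PartialIsometry

variable {V W : Type*} [AddCommGroup V] [Module ℂ V] [AddCommGroup W] [Module ℂ W]

/-- The sesquilinear form on `V ⊗ W` with `⟨v ⊗ w, v' ⊗ w'⟩ = ⟨v, v'⟩ * ⟨w, w'⟩`. -/
noncomputable def tensorForm (β : V →ₗ⋆[ℂ] V →ₗ[ℂ] ℂ) (γ : W →ₗ⋆[ℂ] W →ₗ[ℂ] ℂ) :
    (V ⊗[ℂ] W) →ₗ⋆[ℂ] (V ⊗[ℂ] W) →ₗ[ℂ] ℂ :=
  (TensorProduct.map₂ β γ).compr₂ₛₗ (LinearMap.mul' ℂ ℂ)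

lemma tensorForm_tmul (β : V →ₗ⋆[ℂ] V →ₗ[ℂ] ℂ) (γ : W →ₗ⋆[ℂ] W →ₗ[ℂ] ℂ) (v v' : V) (w w' : W) :
    tensorForm β γ (v ⊗ₜ w) (v' ⊗ₜ w') = β v v' * γ w w' := by
  simp [tensorForm]

/-- With respect to the inner products `β` on `V` and `γ` on `W`, the linear map `M : V → W` is a
partial isometry: it preserves inner products on the orthogonal complement of its kernel. -/
def IsPartialIsometry (β : V →ₗ⋆[ℂ] V →ₗ[ℂ] ℂ) (γ : W →ₗ⋆[ℂ] W →ₗ[ℂ] ℂ) (M : V →ₗ[ℂ] W) : Prop :=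
  ∀ x y : V, (∀ k, M k = 0 → β k x = 0) → (∀ k, M k = 0 → β k y = 0) → γ (M x) (M y) = β x y

end PartialIsometry

section Algebra

variable {B : Type u} [Category.{v} B] [MonoidalCategory B]

/-- The algebra `A` is separable: its multiplication `A ⊗ A ⟶ A` has a section
`s : A ⟶ A ⊗ A` which is a morphism of `(A, A)`-bimodules. -/
def IsSeparableAlgebra (A : B) [MonObj A] : Prop :=
  ∃ s : A ⟶ A ⊗ A,
    s ≫ MonObj.mul = 𝟙 A ∧
    (A ◁ s) ≫ (α_ A A A).inv ≫ (MonObj.mul ▷ A) = MonObj.mul ≫ s ∧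
    (s ▷ A) ≫ (α_ A A A).hom ≫ (A ◁ MonObj.mul) = MonObj.mul ≫ s

variable [Abelian B] [Linear ℂ B] [MonoidalPreadditive B] [MonoidalLinear ℂ B]

/-- The algebra `A` is connected: `Hom(𝟙, A)` is one-dimensional. -/
def IsConnectedAlgebra (A : B) : Prop :=
  Module.finrank ℂ (𝟙_ B ⟶ A) = 1

/-- The linear map `Hom(a, A) ⊗ Hom(b, A) → Hom(a ⊗ b, A)`, `f ⊗ g ↦ m ∘ (f ⊗ g)`. -/
noncomputable def mulHom (A : B) [MonObj A] (a b : B) :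
    ((a ⟶ A) ⊗[ℂ] (b ⟶ A)) →ₗ[ℂ] (a ⊗ b ⟶ A) :=
  TensorProduct.lift <| LinearMap.mk₂ ℂ (fun f g => (f ⊗ₘ g) ≫ MonObj.mul)
    (fun f f' g => by simp [MonoidalCategory.tensorHom_def])
    (fun c f g => by simp [MonoidalCategory.tensorHom_def])
    (fun f g g' => by simp [MonoidalCategory.tensorHom_def])
    (fun c f g => by simp [MonoidalCategory.tensorHom_def])

end Algebra

end UnitaryFusion

/-! Write R for the `*`-algebra End A with its trace, F * G = m ∘ (F ⊗ G) ∘ m† for convolution, and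
φ(F) = Tr(T†T F). Cyclicity gives ⟨f, g⟩_T = φ(g f†), and inner products of values of M become φ of
convolutions (`homForm_mulHom`). An injective partial isometry is just an isometry, so the condition
on all M_{a,b} says exactly that φ is multiplicative for convolution; the case a = b = A, tested
against id ⊗ id, already gives this back. It remains to show that A is separable iff some T makes φ
multiplicative.

Separable implies multiplicative. Convolution is associative and preserves positivity, and a
connected separable algebra has no proper nonzero left ideals (`eq_zero_of_left_mul`), so the
adjoint of F ↦ 1 * F maps nonzero positive elements to strictly positive ones. By Perron–Frobenius
it has a strictly positive eigenvector H, unique up to scale among positive eigenvectors of the same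
eigenvalue. The adjoints of right convolutions by positive elements commute with it, so H is an
eigenvector of each of them, and F ↦ Tr(H F), once normalized, is multiplicative. Take T to be the
square root of the normalized H (`exists_multiplicative`).

Multiplicative implies separable. Let t : A → 1 be the trace of left multiplication. If a nonzero y
were in the radical of the form t ∘ m, an operator built from y y† would have powers of trace zero
and so be nilpotent, while φ takes the nonzero values φ(1) φ(y y†)^n on the corresponding
convolution powers (`eq_zero_of_mulTrace`). So t ∘ m is nondegenerate and A is Frobenius. Its
comultiplication is a bimodule map, its composite with m is a scalar by connectedness, and comparing
traces shows the scalar is 1.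

The canonical trace needs an argument of its own: standard duals exist because the left and right
traces of any duality can be balanced (`exists_balancing`), and the resulting trace is cyclic and
independent of choices (`tr_comm`). -/

set_option linter.unusedSectionVars false

/-! ### Finite-dimensional `*`-algebras with a faithful positive functional, and their C*-norm -/

section StarAlgebra

open scoped ComplexOrder InnerProductSpace

variable {R : Type*} [Ring R] [Algebra ℂ R] [StarRing R] [StarModule ℂ R]

/-- A linear functional on a complex `*`-algebra is faithful and positive. -/
def IsFaithfulPositive (φ : R →ₗ[ℂ] ℂ) : Prop := ∀ x : R, x ≠ 0 → 0 < φ (star x * x)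

namespace IsFaithfulPositive

variable {φ : R →ₗ[ℂ] ℂ}

lemma nonneg (h : IsFaithfulPositive φ) (x : R) : 0 ≤ φ (star x * x) := by
  rcases eq_or_ne x 0 with rfl | hx
  · simp
  · exact (h x hx).le

lemma eq_zero (h : IsFaithfulPositive φ) {x : R} (hx : φ (star x * x) = 0) : x = 0 := by
  by_contra hne
  exact (h x hne).ne' hx

/-- Polarization: φ is real on y*y for y = 1, x, 1 + x and 1 + ix, which fixes the imaginary and
real parts of φ(x*) in terms of φ(x). -/
lemma map_star (h : IsFaithfulPositive φ) (x : R) : φ (star x) = star (φ x) := by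
  have h0 := (Complex.nonneg_iff.1 (h.nonneg 1)).2
  have h1 := (Complex.nonneg_iff.1 (h.nonneg x)).2
  have h2 := (Complex.nonneg_iff.1 (h.nonneg (1 + x))).2
  have h3 := (Complex.nonneg_iff.1 (h.nonneg (1 + Complex.I • x))).2
  simp [mul_add, add_mul] at h0 h1 h2 h3
  apply Complex.ext
  · simp; linarith
  · simp; linarith

end IsFaithfulPositive

/-- The Hilbert space attached to a faithful positive functional. -/
@[nolint unusedArguments]
def GNSSpace {φ : R →ₗ[ℂ] ℂ} (_ : IsFaithfulPositive φ) : Type _ := R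

namespace GNSSpace

variable {φ : R →ₗ[ℂ] ℂ} (h : IsFaithfulPositive φ)

instance : AddCommGroup (GNSSpace h) := inferInstanceAs (AddCommGroup R)

instance : Module ℂ (GNSSpace h) := inferInstanceAs (Module ℂ R)

instance [FiniteDimensional ℂ R] : FiniteDimensional ℂ (GNSSpace h) :=
  inferInstanceAs (FiniteDimensional ℂ R)

/-- The inner product `φ (x* y)`. -/
@[reducible]
def core : InnerProductSpace.Core ℂ (GNSSpace h) where
  inner x y := φ (star (show R from x) * (show R from y))
  conj_inner_symm x y := by
    have key : ∀ a b : R, star (φ (star b * a)) = φ (star a * b) := fun a b => by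
      rw [← h.map_star]; simp
    exact key x y
  re_inner_nonneg x := (Complex.nonneg_iff.1 (h.nonneg (show R from x))).1
  add_left x y z := by
    have key : ∀ a b c : R, φ (star (a + b) * c) = φ (star a * c) + φ (star b * c) := by
      simp [add_mul]
    exact key x y z
  smul_left x y r := by
    have key : ∀ a b : R, φ (star (r • a) * b) = star r * φ (star a * b) := by simp
    exact key x y
  definite x hx := h.eq_zero hx

noncomputable instance : NormedAddCommGroup (GNSSpace h) := (core h).toNormedAddCommGroup

noncomputable instance : InnerProductSpace ℂ (GNSSpace h) := InnerProductSpace.ofCore (core h).toCore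

variable [FiniteDimensional ℂ R]

/-- Left multiplication, as a representation by bounded operators. -/
noncomputable def rep : R →ₐ[ℂ] (GNSSpace h →L[ℂ] GNSSpace h) :=
  (Module.End.toContinuousLinearMap (𝕜 := ℂ) (GNSSpace h)).toAlgHom.comp
    (show R →ₐ[ℂ] Module.End ℂ (GNSSpace h) from Algebra.lmul ℂ R)

lemma rep_apply (x y : R) : rep h x (show GNSSpace h from y) = (show GNSSpace h from x * y) := rfl

lemma rep_injective : Function.Injective (rep h) := by
  intro x y hxy
  have := congrArg (fun f => f (show GNSSpace h from (1 : R))) hxy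
  simp only [rep_apply] at this
  simpa using (show x * 1 = y * 1 from this)

lemma rep_star (x : R) : rep h (star x) = star (rep h x) := by
  have : CompleteSpace (GNSSpace h) := FiniteDimensional.complete ℂ _
  rw [ContinuousLinearMap.star_eq_adjoint, ContinuousLinearMap.eq_adjoint_iff]
  intro y z
  have key : ∀ a b : R, φ (star (star x * a) * b) = φ (star a * (x * b)) := by simp [mul_assoc]
  exact key y z

end GNSSpace

/-- A finite-dimensional complex `*`-algebra with a faithful positive functional is a
`C*`-algebra. -/
@[reducible]
noncomputable def IsFaithfulPositive.cstarAlgebra [FiniteDimensional ℂ R] {φ : R →ₗ[ℂ] ℂ}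
    (h : IsFaithfulPositive φ) : CStarAlgebra R :=
  letI : NormedRing R := NormedRing.induced R _ (GNSSpace.rep h) (GNSSpace.rep_injective h)
  letI : NormedAlgebra ℂ R := NormedAlgebra.induced ℂ R _ (GNSSpace.rep h)
  haveI : CompleteSpace (GNSSpace h) := FiniteDimensional.complete ℂ _
  haveI : CompleteSpace R := FiniteDimensional.complete ℂ _
  haveI : CStarRing R := ⟨fun {x} => by
    change ‖GNSSpace.rep h x‖ * ‖GNSSpace.rep h x‖ ≤ ‖GNSSpace.rep h (star x * x)‖
    rw [map_mul, GNSSpace.rep_star]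
    exact (CStarRing.norm_star_mul_self (x := GNSSpace.rep h x)).ge⟩
  { }

/-- In an orthonormal basis b_i of the GNS space, the trace of left multiplication by x*x is the sum
of the φ((x b_i)*(x b_i)). With `trace_mulLeft_comm` this produces a faithful positive functional
that is tracial, whatever φ was. -/
lemma IsFaithfulPositive.trace_mulLeft [FiniteDimensional ℂ R] {φ : R →ₗ[ℂ] ℂ}
    (h : IsFaithfulPositive φ) :
    IsFaithfulPositive ((LinearMap.trace ℂ R).comp (LinearMap.mul ℂ R)) := by
  intro x hx
  let b := stdOrthonormalBasis ℂ (GNSSpace h)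
  have key : LinearMap.trace ℂ R (LinearMap.mul ℂ R (star x * x)) =
      ∑ i, φ (star (x * (show R from b i)) * (x * (show R from b i))) := by
    refine (LinearMap.trace_eq_sum_inner (𝕜 := ℂ) (E := GNSSpace h)
      (LinearMap.mul ℂ R (star x * x)) b).trans ?_
    refine Finset.sum_congr rfl fun i _ => ?_
    have key : ∀ a : R, φ (star a * ((star x * x) * a)) = φ (star (x * a) * (x * a)) := by
      simp [mul_assoc]
    exact key (b i)
  change 0 < LinearMap.trace ℂ R (LinearMap.mul ℂ R (star x * x))
  rw [key]
  refine Finset.sum_pos' (fun i _ => h.nonneg _) ?_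
  by_contra hcon
  push Not at hcon
  apply hx
  have h0 : ∀ i, x * (show R from b i) = 0 := fun i => by
    by_contra hne
    exact hcon i (Finset.mem_univ i) (h _ hne)
  have h1 : (LinearMap.mul ℂ R x : R →ₗ[ℂ] R) = 0 :=
    (show (LinearMap.mul ℂ R x : GNSSpace h →ₗ[ℂ] GNSSpace h) = 0 from
      b.toBasis.ext fun i => by
        rw [OrthonormalBasis.coe_toBasis]
        exact h0 i)
  simpa using congrArg (fun f : R →ₗ[ℂ] R => f 1) h1

lemma trace_mulLeft_comm (x y : R) :
    (LinearMap.trace ℂ R).comp (LinearMap.mul ℂ R) (x * y) =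
      (LinearMap.trace ℂ R).comp (LinearMap.mul ℂ R) (y * x) := by
  have : ∀ a b : R, LinearMap.mul ℂ R (a * b) =
      (LinearMap.mul ℂ R a : Module.End ℂ R) * (LinearMap.mul ℂ R b : Module.End ℂ R) := by
    intro a b
    ext z
    simp [mul_assoc]
  simp only [LinearMap.comp_apply]
  rw [this, this]
  exact LinearMap.trace_mul_comm ℂ _ _

end StarAlgebra

/-! ### Perron–Frobenius theory for the positive cone, and densities with respect to a trace -/

section CStar

open scoped ComplexOrder

variable {R : Type*} [CStarAlgebra R] [PartialOrder R] [StarOrderedRing R]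

/-- The spectrum of y is bounded below by some r > 0, and z ≤ ‖z‖. Dividing r by ‖z‖ + 1 instead of
‖z‖ covers z = 0. -/
lemma IsStrictlyPositive.exists_smul_le [Nontrivial R] {y : R} (hy : IsStrictlyPositive y) (z : R)
    (hz : 0 ≤ z) : ∃ ε : ℝ, 0 < ε ∧ ε • z ≤ y := by
  obtain ⟨r, hr, hle⟩ := (CFC.exists_pos_algebraMap_le_iff hy.isSelfAdjoint).2
    fun x hx => hy.spectrum_pos hx
  have hz' : z ≤ algebraMap ℝ R ‖z‖ := (IsSelfAdjoint.of_nonneg hz).le_algebraMap_norm_self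
  have hn : 0 < ‖z‖ + 1 := by positivity
  refine ⟨r / (‖z‖ + 1), by positivity, le_trans ?_ hle⟩
  have h1 : z ≤ algebraMap ℝ R (‖z‖ + 1) := hz'.trans (by
    rw [map_add, map_one]
    exact le_add_of_nonneg_right zero_le_one)
  calc (r / (‖z‖ + 1)) • z ≤ (r / (‖z‖ + 1)) • algebraMap ℝ R (‖z‖ + 1) :=
        smul_le_smul_of_nonneg_left h1 (by positivity)
    _ = algebraMap ℝ R r := by
        rw [Algebra.algebraMap_eq_smul_one, Algebra.algebraMap_eq_smul_one, smul_smul,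
          div_mul_cancel₀ _ hn.ne']

/-- A Perron–Frobenius theorem: existence of a positive eigenvector of a strictly positive map. -/
theorem exists_isStrictlyPositive_eigenvector [FiniteDimensional ℂ R] [Nontrivial R]
    (Φ : R →ₗ[ℂ] R) (hΦ : ∀ x, 0 ≤ x → x ≠ 0 → IsStrictlyPositive (Φ x)) :
    ∃ (H : R) (r : ℝ), IsStrictlyPositive H ∧ 0 < r ∧ Φ H = r • H := by
  have : ProperSpace R := FiniteDimensional.proper ℂ R
  let L : R →L[ℂ] R := LinearMap.toContinuousLinearMap Φ
  have hL : ∀ x, L x = Φ x := fun x => rfl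
  have hΦr : ∀ (r : ℝ) x, Φ (r • x) = r • Φ x := fun r x => by
    rw [← Complex.coe_smul, map_smul, Complex.coe_smul]
  -- Collatz–Wielandt: maximize r over the pairs with r x ≤ Φ x and x positive of norm 1. The bound
  -- by the operator norm makes this set compact.
  let K : Set (ℝ × R) := {p | p.1 ∈ Set.Icc 0 ‖L‖ ∧ p.2 ∈ Metric.sphere (0 : R) 1 ∧ 0 ≤ p.2 ∧
    p.1 • p.2 ≤ L p.2}
  have hbound : ∀ (r : ℝ) (x : R), 0 ≤ r → ‖x‖ = 1 → 0 ≤ x → r • x ≤ L x → r ≤ ‖L‖ := by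
    intro r x hr hx hx0 hle
    have h1 := CStarAlgebra.norm_le_norm_of_nonneg_of_le (smul_nonneg hr hx0) hle
    rw [norm_smul, hx, mul_one, Real.norm_of_nonneg hr] at h1
    exact h1.trans (by simpa [hx] using L.le_opNorm x)
  have hKc : IsCompact K := by
    refine IsCompact.of_isClosed_subset
      ((isCompact_Icc (a := (0 : ℝ)) (b := ‖L‖)).prod (isCompact_sphere (0 : R) 1)) ?_
      (fun p hp => ⟨hp.1, hp.2.1⟩)
    refine IsClosed.inter (isClosed_Icc.preimage continuous_fst) (IsClosed.inter
      (Metric.isClosed_sphere.preimage continuous_snd) (IsClosed.inter ?_ ?_))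
    · exact isClosed_le continuous_const continuous_snd
    · exact isClosed_le (continuous_fst.smul continuous_snd) (L.continuous.comp continuous_snd)
  have hKne : K.Nonempty := by
    refine ⟨(0, 1), ⟨le_rfl, norm_nonneg _⟩, by simp, zero_le_one, ?_⟩
    simpa [hL] using (hΦ 1 zero_le_one one_ne_zero).nonneg
  obtain ⟨⟨r, x⟩, ⟨⟨hr0, -⟩, hx1, hx0, hle⟩, hmax⟩ :=
    hKc.exists_isMaxOn hKne continuous_fst.continuousOn
  simp only at hr0 hx1 hx0 hle
  have hx1 : ‖x‖ = 1 := by simpa using hx1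
  have hxne : x ≠ 0 := by rintro rfl; simp at hx1
  have hΦx := hΦ x hx0 hxne
  have hΦx0 : Φ x ≠ 0 := hΦx.isUnit.ne_zero
  have heq : Φ x = r • x := by
    by_contra hne
    have hy : 0 ≤ Φ x - r • x := sub_nonneg.2 hle
    -- If Φ x ≠ r x, then Φ of the difference dominates ε Φ x, so the normalized Φ x achieves r + ε
    -- and contradicts maximality.
    obtain ⟨ε, hε, hεle⟩ := (hΦ _ hy (sub_ne_zero.2 hne)).exists_smul_le (Φ x) hΦx.nonneg
    have hnorm : 0 < ‖Φ x‖ := norm_pos_iff.2 hΦx0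
    have h1 : (r + ε) • Φ x ≤ Φ (Φ x) := by
      rw [map_sub, hΦr] at hεle
      rw [add_smul, add_comm]
      exact le_sub_iff_add_le.1 hεle
    have h2 : (r + ε) • (‖Φ x‖⁻¹ • Φ x) ≤ L (‖Φ x‖⁻¹ • Φ x) := by
      rw [hL, hΦr, smul_comm]
      exact smul_le_smul_of_nonneg_left h1 (by positivity)
    have h3 : ‖‖Φ x‖⁻¹ • Φ x‖ = 1 := by
      rw [norm_smul, norm_inv, norm_norm, inv_mul_cancel₀ hnorm.ne']
    have h4 : 0 ≤ ‖Φ x‖⁻¹ • Φ x := smul_nonneg (by positivity) hΦx.nonneg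
    have h5 := hmax (show (r + ε, ‖Φ x‖⁻¹ • Φ x) ∈ K from
      ⟨⟨by positivity, hbound _ _ (by positivity) h3 h4 h2⟩, by simpa using h3, h4, h2⟩)
    simp only [Set.mem_ofPred_eq] at h5
    linarith
  have hr : 0 < r := by
    refine lt_of_le_of_ne hr0 ?_
    rintro rfl
    exact hΦx0 (by simp [heq])
  refine ⟨x, r, ?_, hr, heq⟩
  have : x = r⁻¹ • Φ x := by rw [heq, smul_smul, inv_mul_cancel₀ hr.ne', one_smul]
  rw [IsStrictlyPositive.iff_of_unital]
  refine ⟨hx0, ?_⟩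
  rw [this, ← Complex.coe_smul]
  exact hΦx.isUnit.smul (Units.mk0 ((r⁻¹ : ℝ) : ℂ) (by simpa using hr.ne'))

/-- The eigenvalue of a positive eigenvector of a strictly positive map is geometrically simple
within the positive cone. -/
theorem eigenvector_unique [FiniteDimensional ℂ R] [Nontrivial R]
    (Φ : R →ₗ[ℂ] R) (hΦ : ∀ x, 0 ≤ x → x ≠ 0 → IsStrictlyPositive (Φ x))
    {H : R} {r : ℝ} (hH : IsStrictlyPositive H) (hr : 0 < r) (hHr : Φ H = r • H)
    {z : R} (hz : 0 ≤ z) (hzr : Φ z = r • z) : ∃ t : ℝ, z = t • H := by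
  have hΦr : ∀ (r : ℝ) x, Φ (r • x) = r • Φ x := fun r x => by
    rw [← Complex.coe_smul, map_smul, Complex.coe_smul]
  have hHn : 0 < ‖H‖ := norm_pos_iff.2 hH.isUnit.ne_zero
  -- Take the largest t with t H ≤ z. If z - t H is nonzero, being an eigenvector it dominates a
  -- positive multiple of H, and t can be increased.
  let K : Set ℝ := {t | t ∈ Set.Icc 0 (‖z‖ / ‖H‖) ∧ t • H ≤ z}
  have hbound : ∀ t : ℝ, 0 ≤ t → t • H ≤ z → t ≤ ‖z‖ / ‖H‖ := by
    intro t ht hle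
    have h1 := CStarAlgebra.norm_le_norm_of_nonneg_of_le (smul_nonneg ht hH.nonneg) hle
    rw [norm_smul, Real.norm_of_nonneg ht] at h1
    rwa [le_div_iff₀ hHn]
  have hKc : IsCompact K := isCompact_Icc.inter_right
    (isClosed_le (continuous_id.smul continuous_const) continuous_const)
  have hKne : K.Nonempty := ⟨0, ⟨le_rfl, by positivity⟩, by simpa using hz⟩
  obtain ⟨t, ⟨⟨ht0, -⟩, hle⟩, hmax⟩ := hKc.exists_isMaxOn hKne continuous_id.continuousOn
  refine ⟨t, ?_⟩
  by_contra hne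
  obtain ⟨ε, hε, hεle⟩ := (hΦ _ (sub_nonneg.2 hle) (sub_ne_zero.2 hne)).exists_smul_le H hH.nonneg
  have h1 : (t + ε / r) • H ≤ z := by
    have : Φ (z - t • H) = r • (z - t • H) := by
      rw [map_sub, hΦr, hzr, hHr, smul_sub, smul_comm]
    rw [this] at hεle
    have h2 := smul_le_smul_of_nonneg_left hεle (inv_pos.2 hr).le
    rw [smul_smul, smul_smul, inv_mul_cancel₀ hr.ne', one_smul, inv_mul_eq_div] at h2
    rw [add_smul, add_comm]
    exact le_sub_iff_add_le.1 h2
  have h2 := hmax (show t + ε / r ∈ K from ⟨⟨by positivity, hbound _ (by positivity) h1⟩, h1⟩)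
  simp only [id, Set.mem_ofPred_eq] at h2
  have : 0 < ε / r := by positivity
  linarith

variable {τ : R →ₗ[ℂ] ℂ}

namespace IsFaithfulPositive

lemma trace_mul_nonneg (hτ : IsFaithfulPositive τ) (htr : ∀ x y, τ (x * y) = τ (y * x)) {a b : R}
    (ha : 0 ≤ a) (hb : 0 ≤ b) : 0 ≤ τ (a * b) := by
  obtain ⟨x, rfl⟩ := CStarAlgebra.nonneg_iff_eq_star_mul_self.1 ha
  obtain ⟨y, rfl⟩ := CStarAlgebra.nonneg_iff_eq_star_mul_self.1 hb
  have := hτ.nonneg (x * star y)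
  rw [star_mul, star_star, mul_assoc, htr] at this
  simpa [mul_assoc] using this

lemma eq_zero_of_trace_mul (hτ : IsFaithfulPositive τ) {a : R} (h : ∀ x, τ (a * x) = 0) :
    a = 0 := by
  have := hτ.eq_zero (x := star a) (by simpa using h (star a))
  simpa using this

/-- The element which represents a functional. -/
lemma exists_density [FiniteDimensional ℂ R] (hτ : IsFaithfulPositive τ) (ψ : R →ₗ[ℂ] ℂ) :
    ∃ a : R, ∀ x, ψ x = τ (a * x) := by
  let D : R →ₗ[ℂ] Module.Dual ℂ R := (LinearMap.mul ℂ R).compr₂ τ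
  have hinj : Function.Injective D := by
    rw [injective_iff_map_eq_zero]
    exact fun a ha => hτ.eq_zero_of_trace_mul fun x => congrArg (fun f => f x) ha
  obtain ⟨a, ha⟩ := (LinearMap.injective_iff_surjective_of_finrank_eq_finrank
    (Subspace.dual_finrank_eq (K := ℂ) (V := R)).symm).1 hinj ψ
  exact ⟨a, fun x => (congrArg (fun f => f x) ha).symm⟩

/-- Polarization makes a self-adjoint. Testing on the negative part of a gives -τ(a⁻ a⁻) ≥ 0, and
faithfulness then forces a⁻ = 0. -/
lemma nonneg_of_trace_mul (hτ : IsFaithfulPositive τ) (htr : ∀ x y, τ (x * y) = τ (y * x)) {a : R}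
    (h : ∀ f, 0 ≤ τ (a * (star f * f))) : 0 ≤ a := by
  have hreal : ∀ x, τ (a * star x) = star (τ (a * x)) := by
    intro x
    have h0 := (Complex.nonneg_iff.1 (h 1)).2
    have h1 := (Complex.nonneg_iff.1 (h x)).2
    have h2 := (Complex.nonneg_iff.1 (h (1 + x))).2
    have h3 := (Complex.nonneg_iff.1 (h (1 + Complex.I • x))).2
    simp [mul_add, add_mul] at h0 h1 h2 h3
    apply Complex.ext
    · simp; linarith
    · simp; linarith
  have hsa : star a = a := by
    rw [← sub_eq_zero]
    refine hτ.eq_zero_of_trace_mul fun x => ?_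
    rw [sub_mul, map_sub, sub_eq_zero]
    have h1 := hτ.map_star (star a * x)
    rw [star_mul, star_star, htr, hreal] at h1
    exact (star_injective h1).symm
  have hsa' : IsSelfAdjoint a := hsa
  rw [← CFC.negPart_eq_zero_iff a]
  have hneg : 0 ≤ a⁻ := CFC.negPart_nonneg a
  obtain ⟨f, hf⟩ := CStarAlgebra.nonneg_iff_eq_star_mul_self.1 hneg
  have h1 := h f
  rw [← hf] at h1
  nth_rewrite 1 [← CFC.posPart_sub_negPart a hsa'] at h1
  rw [sub_mul, CFC.posPart_mul_negPart, zero_sub, map_neg] at h1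
  have h2 : 0 ≤ τ (star (a⁻) * a⁻) := hτ.nonneg _
  rw [(IsSelfAdjoint.of_nonneg hneg).star_eq] at h2
  refine hτ.eq_zero ?_
  rw [(IsSelfAdjoint.of_nonneg hneg).star_eq]
  exact le_antisymm (neg_nonneg.1 h1) h2

lemma isStrictlyPositive_of_trace_mul [FiniteDimensional ℂ R] (hτ : IsFaithfulPositive τ)
    (htr : ∀ x y, τ (x * y) = τ (y * x)) {a : R}
    (h : ∀ f, f ≠ 0 → 0 < τ (a * (star f * f))) : IsStrictlyPositive a := by
  have ha : 0 ≤ a := hτ.nonneg_of_trace_mul htr fun f => by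
    rcases eq_or_ne f 0 with rfl | hf
    · simp
    · exact (h f hf).le
  have hinj : Function.Injective (LinearMap.mulLeft ℂ a) := by
    rw [injective_iff_map_eq_zero]
    intro f hf
    by_contra hne
    have h1 := h (star f) (by simpa using hne)
    rw [star_star, ← mul_assoc] at h1
    have h2 : a * f = 0 := hf
    simp [h2] at h1
  obtain ⟨b, hb⟩ := LinearMap.injective_iff_surjective.1 hinj 1
  have hb' : a * b = 1 := hb
  have hb2 : star b * a = 1 := by
    have := congrArg star hb'
    rwa [star_mul, (IsSelfAdjoint.of_nonneg ha).star_eq, star_one] at this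
  exact ⟨ha, isUnit_iff_exists_and_exists.2 ⟨⟨b, hb'⟩, ⟨star b, hb2⟩⟩⟩

end IsFaithfulPositive

end CStar

/-! ### Balancing two functionals; the multiplicative functional -/

section

open scoped ComplexOrder

variable {R : Type*}

namespace IsFaithfulPositive

/-- Two faithful positive functionals become intertwined after conjugation by an invertible
element. -/
theorem exists_balancing [Ring R] [Algebra ℂ R] [StarRing R] [StarModule ℂ R]
    [FiniteDimensional ℂ R] {α β : R →ₗ[ℂ] ℂ} (hα : IsFaithfulPositive α)
    (hβ : IsFaithfulPositive β) :
    ∃ h : Rˣ, ∀ f, α (h * f * star (h : R)) = β (star ((h⁻¹ : Rˣ) : R) * f * (h⁻¹ : Rˣ)) := by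
  let _ : CStarAlgebra R := hα.cstarAlgebra
  let _ : PartialOrder R := CStarAlgebra.spectralOrder R
  have : StarOrderedRing R := CStarAlgebra.spectralOrderedRing R
  obtain ⟨τ, hτ, htr⟩ : ∃ τ : R →ₗ[ℂ] ℂ, IsFaithfulPositive τ ∧ ∀ x y, τ (x * y) = τ (y * x) :=
    ⟨_, hα.trace_mulLeft, trace_mulLeft_comm⟩
  obtain ⟨a, ha⟩ := hτ.exists_density α
  obtain ⟨b, hb⟩ := hτ.exists_density β
  have hapos : IsStrictlyPositive a := hτ.isStrictlyPositive_of_trace_mul htr fun f hf => by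
    rw [← ha]; exact hα f hf
  have hbpos : IsStrictlyPositive b := hτ.isStrictlyPositive_of_trace_mul htr fun f hf => by
    rw [← hb]; exact hβ f hf
  -- In terms of densities for τ, a self-adjoint h works as soon as k = h² solves k a k = b. A
  -- positive solution is the geometric mean k = a^(-1/2) (a^(1/2) b a^(1/2))^(1/2) a^(-1/2), with s
  -- = a^(1/2) and d the middle square root.
  have hspos := IsStrictlyPositive.sqrt a hapos
  obtain ⟨s, hs⟩ := hspos.isUnit
  rw [← hs] at hspos
  have hss : (s : R) * s = a := by rw [hs]; exact CFC.sqrt_mul_sqrt_self a hapos.nonneg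
  have hssa : star (s : R) = s := hspos.isSelfAdjoint
  have hsia : star ((s⁻¹ : Rˣ) : R) = (s⁻¹ : Rˣ) := by
    have : star s = s := Units.ext hssa
    rw [← Units.coe_star_inv, this]
  have hcpos : IsStrictlyPositive ((s : R) * b * s) := by
    refine ⟨?_, (s.isUnit.mul hbpos.isUnit).mul s.isUnit⟩
    have := star_left_conjugate_nonneg hbpos.nonneg (s : R)
    rwa [hssa] at this
  have hdpos := IsStrictlyPositive.sqrt _ hcpos
  obtain ⟨d, hd⟩ := hdpos.isUnit
  rw [← hd] at hdpos
  have hdd : (d : R) * d = s * b * s := by rw [hd]; exact CFC.sqrt_mul_sqrt_self _ hcpos.nonneg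
  have hkpos : IsStrictlyPositive (((s⁻¹ : Rˣ) : R) * d * (s⁻¹ : Rˣ)) := by
    refine ⟨?_, (Units.isUnit _ |>.mul d.isUnit).mul (Units.isUnit _)⟩
    have := star_left_conjugate_nonneg hdpos.nonneg ((s⁻¹ : Rˣ) : R)
    rwa [hsia] at this
  have hhpos := IsStrictlyPositive.sqrt _ hkpos
  obtain ⟨h, hh⟩ := hhpos.isUnit
  rw [← hh] at hhpos
  have hhh : (h : R) * h = (s⁻¹ : Rˣ) * d * (s⁻¹ : Rˣ) := by
    rw [hh]; exact CFC.sqrt_mul_sqrt_self _ hkpos.nonneg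
  have hhsa : star (h : R) = h := hhpos.isSelfAdjoint
  have hhia : star ((h⁻¹ : Rˣ) : R) = (h⁻¹ : Rˣ) := by
    have : star h = h := Units.ext hhsa
    rw [← Units.coe_star_inv, this]
  have hkak : (h : R) * h * a * (h * h) = b := by
    rw [hhh, ← hss]
    have : ((s⁻¹ : Rˣ) : R) * d * (s⁻¹ : Rˣ) * (s * s) * ((s⁻¹ : Rˣ) * d * (s⁻¹ : Rˣ)) =
        (s⁻¹ : Rˣ) * (d * d) * (s⁻¹ : Rˣ) := by
      simp [mul_assoc]
    rw [this, hdd]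
    simp [mul_assoc]
  refine ⟨h, fun f => ?_⟩
  have e1 : τ (a * (h * f * h)) = τ (h * a * h * f) := by
    rw [← mul_assoc, htr]
    simp [mul_assoc]
  have e2 : τ (h * h * a * (h * h) * ((h⁻¹ : Rˣ) * f * (h⁻¹ : Rˣ))) = τ (h * a * h * f) := by
    rw [← mul_assoc, htr]
    simp [mul_assoc]
  rw [hhsa, hhia, ha, hb, ← hkak, e1, e2]

/-- Existence of a positive definite multiplicative functional for an irreducible positive
product. -/
theorem exists_multiplicative [Ring R] [Algebra ℂ R] [StarRing R] [StarModule ℂ R]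
    [FiniteDimensional ℂ R] {τ : R →ₗ[ℂ] ℂ} (hτ : IsFaithfulPositive τ)
    (htr : ∀ x y, τ (x * y) = τ (y * x)) (P : R →ₗ[ℂ] R →ₗ[ℂ] R) (e : R)
    (hone : ∀ x, P e x = x) (hassoc : ∀ x y z, P (P x y) z = P x (P y z))
    (hpos : ∀ x y, ∃ z, P (star x * x) (star y * y) = star z * z)
    (hirr : ∀ x y, x ≠ 0 → y ≠ 0 → 0 < τ (star x * x * P 1 (star y * y))) :
    ∃ T : Rˣ, ∀ F G, τ (star (T : R) * T * P F G) =
      τ (star (T : R) * T * F) * τ (star (T : R) * T * G) := by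
  rcases subsingleton_or_nontrivial R with hsub | hnon
  · exact ⟨1, fun F G => by
      have : ∀ x : R, τ x = 0 := fun x => by rw [Subsingleton.elim x 0, map_zero]
      simp [this]⟩
  let _ : CStarAlgebra R := hτ.cstarAlgebra
  let _ : PartialOrder R := CStarAlgebra.spectralOrder R
  have : StarOrderedRing R := CStarAlgebra.spectralOrderedRing R
  have hadj : ∀ S : R →ₗ[ℂ] R, ∃ S' : R →ₗ[ℂ] R, ∀ H G, τ (S' H * G) = τ (H * S G) := by
    intro S
    choose f hf using fun H : R => hτ.exists_density (τ.comp ((LinearMap.mul ℂ R H).comp S))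
    refine ⟨{ toFun := f, map_add' := fun x y => ?_, map_smul' := fun c x => ?_ },
      fun H G => (hf H G).symm⟩
    · rw [← sub_eq_zero]
      refine hτ.eq_zero_of_trace_mul fun z => ?_
      rw [sub_mul, add_mul, map_sub, map_add, ← hf, ← hf, ← hf]
      simp
    · rw [← sub_eq_zero]
      refine hτ.eq_zero_of_trace_mul fun z => ?_
      rw [sub_mul, RingHom.id_apply, smul_mul_assoc, map_sub, map_smul, ← hf, ← hf]
      simp
  -- The adjoint for the pairing τ(x y), so that eigenvectors of Φ are densities of eigenfunctionals
  -- of P 1.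
  obtain ⟨Φ, hΦ⟩ := hadj (P 1)
  have hΦpos : ∀ x, 0 ≤ x → x ≠ 0 → IsStrictlyPositive (Φ x) := by
    intro x hx hx0
    obtain ⟨x, rfl⟩ := CStarAlgebra.nonneg_iff_eq_star_mul_self.1 hx
    refine hτ.isStrictlyPositive_of_trace_mul htr fun f hf => ?_
    rw [hΦ]
    exact hirr x f (by rintro rfl; simp at hx0) hf
  obtain ⟨H, r, hH, hr, hHr⟩ := exists_isStrictlyPositive_eigenvector Φ hΦpos
  -- Right multiplication by f*f for the product P commutes with P 1 by associativity, so its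
  -- adjoint Ψ sends H to a positive eigenvector of Φ for the same r, and uniqueness makes Ψ H a
  -- multiple of H.
  have heig : ∀ f, ∃ t : ℝ, ∀ G, τ (H * P G (star f * f)) = t * τ (H * G) := by
    intro f
    obtain ⟨Ψ, hΨ⟩ := hadj (P.flip (star f * f))
    have hΨpos : 0 ≤ Ψ H := hτ.nonneg_of_trace_mul htr fun g => by
      rw [hΨ, LinearMap.flip_apply]
      obtain ⟨z, hz⟩ := hpos g f
      rw [hz]
      exact hτ.trace_mul_nonneg htr hH.nonneg (star_mul_self_nonneg z)
    have hcomm : Φ (Ψ H) = r • Ψ H := by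
      rw [← Complex.coe_smul, ← map_smul, Complex.coe_smul, ← hHr, ← sub_eq_zero]
      refine hτ.eq_zero_of_trace_mul fun z => ?_
      rw [sub_mul, map_sub, sub_eq_zero, hΦ, hΨ, hΨ, hΦ]
      simp [hassoc]
    obtain ⟨t, ht⟩ := eigenvector_unique Φ hΦpos hH hr hHr hΨpos hcomm
    refine ⟨t, fun G => ?_⟩
    have := hΨ H G
    rw [LinearMap.flip_apply] at this
    rw [← this, ht, ← Complex.coe_smul, smul_mul_assoc, map_smul, smul_eq_mul]
  -- The eigenvalue for a positive F is read off at G = e; linearity extends the identity, as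
  -- positive elements span R.
  have hmul : ∀ F G, τ (H * P G F) * τ (H * e) = τ (H * F) * τ (H * G) := by
    intro F G
    have hF : F ∈ Submodule.span ℂ {a : R | 0 ≤ a} := by
      rw [CStarAlgebra.span_nonneg]; trivial
    induction hF using Submodule.span_induction with
    | mem x hx =>
      obtain ⟨f, rfl⟩ := CStarAlgebra.nonneg_iff_eq_star_mul_self.1 (show 0 ≤ x from hx)
      obtain ⟨t, ht⟩ := heig f
      have h1 := ht e
      rw [hone] at h1
      rw [ht, h1]
      ring
    | zero => simp
    | add x y _ _ hx hy => simp only [map_add, mul_add, add_mul, hx, hy]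
    | smul c x _ hx =>
      simp only [map_smul, mul_smul_comm, smul_eq_mul]
      linear_combination c * hx
  have hHtr : 0 < τ H := by
    obtain ⟨x, rfl⟩ := CStarAlgebra.nonneg_iff_eq_star_mul_self.1 hH.nonneg
    exact hτ x (by rintro rfl; exact hH.isUnit.ne_zero (by simp))
  -- From τ(H P(1, 1)) τ(H e) = τ(H)², where the first factor and the right side are positive.
  have hHe : 0 < τ (H * e) := by
    have h1 := hmul 1 1
    have h2 : 0 < τ (H * P 1 1) := by
      obtain ⟨x, rfl⟩ := CStarAlgebra.nonneg_iff_eq_star_mul_self.1 hH.nonneg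
      simpa using hirr x 1 (by rintro rfl; exact hH.isUnit.ne_zero (by simp)) one_ne_zero
    rw [mul_one] at h1
    exact pos_of_mul_pos_right (a := τ (H * P 1 1)) (by rw [h1]; exact mul_pos hHtr hHtr) h2.le
  obtain ⟨c, hc⟩ : ∃ c : ℝ, (c : ℂ) = τ (H * e) :=
    ⟨(τ (H * e)).re, Complex.ext rfl (by simpa using (Complex.pos_iff.1 hHe).2)⟩
  rw [← hc] at hHe hmul
  have hc0 : 0 < c := by exact_mod_cast hHe
  have hH' : IsStrictlyPositive (c⁻¹ • H) := by
    refine ⟨smul_nonneg (inv_pos.2 hc0).le hH.nonneg, ?_⟩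
    rw [← Complex.coe_smul]
    exact hH.isUnit.smul (Units.mk0 ((c⁻¹ : ℝ) : ℂ) (by simpa using hc0.ne'))
  have hT := IsStrictlyPositive.sqrt _ hH'
  obtain ⟨T, hTe⟩ := hT.isUnit
  rw [← hTe] at hT
  have hTT : star (T : R) * T = ((c : ℂ)⁻¹) • H := by
    rw [hT.isSelfAdjoint.star_eq, hTe, CFC.sqrt_mul_sqrt_self _ hH'.nonneg, ← Complex.coe_smul,
      Complex.ofReal_inv]
  refine ⟨T, fun F G => ?_⟩
  have hc1 : (c : ℂ) ≠ 0 := by exact_mod_cast hc0.ne'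
  simp only [hTT, smul_mul_assoc, map_smul, smul_eq_mul]
  have := hmul G F
  field_simp
  linear_combination this

end IsFaithfulPositive

end

/-! ### Idempotents and nilpotents detected by a faithful trace -/

section

open scoped ComplexOrder

variable {R : Type*} [Ring R] [Algebra ℂ R] [StarRing R] [StarModule ℂ R] [FiniteDimensional ℂ R]

namespace IsFaithfulPositive

variable {τ : R →ₗ[ℂ] ℂ}

/-- The range projection of a self-adjoint element. -/
lemma exists_range_projection (hτ : IsFaithfulPositive τ) {h : R} (hh : star h = h) :
    ∃ z : R, star (h * z) = h * z ∧ h * z * h = h := by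
  let L : R →ₗ[ℂ] R := LinearMap.mulLeft ℂ h
  -- Self-adjointness gives ker h² = ker h, hence equal ranges, so h = h² z for some z, and h z is
  -- the projection.
  have hker : LinearMap.ker (L ∘ₗ L) = LinearMap.ker L := by
    ext f
    simp only [LinearMap.mem_ker, LinearMap.comp_apply, L, LinearMap.mulLeft_apply]
    refine ⟨fun hf => hτ.eq_zero ?_, fun hf => by rw [hf, mul_zero]⟩
    rw [star_mul, hh, mul_assoc, hf, mul_zero, map_zero]
  have hrange : LinearMap.range (L ∘ₗ L) = LinearMap.range L := by
    refine Submodule.eq_of_le_of_finrank_eq (LinearMap.range_comp_le_range L L) ?_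
    have h1 := LinearMap.finrank_range_add_finrank_ker (L ∘ₗ L)
    have h2 := LinearMap.finrank_range_add_finrank_ker L
    rw [hker] at h1
    omega
  obtain ⟨z, hz⟩ : h ∈ LinearMap.range (L ∘ₗ L) := by
    rw [hrange]
    exact ⟨1, by simp [L]⟩
  have hz : h * (h * z) = h := hz
  have hz' : star (h * z) * h = h := by
    have := congrArg star hz
    rwa [star_mul, hh] at this
  have hQ : star (h * z) * (h * z) = h * z := by rw [← mul_assoc, hz']
  have hsa : star (h * z) = h * z := by
    have := congrArg star hQ
    rw [star_mul, star_star, hQ] at this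
    exact this.symm
  exact ⟨z, hsa, by rwa [hsa] at hz'⟩

/-- The range projection Q of E E* satisfies E Q = Q and Q E = E, so τ(Q*Q) = τ(Q) = τ(E) = 0. -/
lemma eq_zero_of_idempotent (hτ : IsFaithfulPositive τ) (htr : ∀ x y, τ (x * y) = τ (y * x)) {E : R}
    (hE : E * E = E) (h0 : τ E = 0) : E = 0 := by
  obtain ⟨z, hz1, hz2⟩ := hτ.exists_range_projection (h := E * star E) (by simp)
  set Q := E * star E * z with hQ
  have hEQ : E * Q = Q := by rw [hQ, ← mul_assoc, ← mul_assoc, hE]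
  have hQE : Q * E = E := by
    rw [← sub_eq_zero, ← star_eq_zero]
    refine hτ.eq_zero ?_
    rw [star_star, star_sub, star_mul, hz1, sub_mul, mul_sub, mul_sub]
    have h1 : Q * E * (star E * Q) = E * star E * Q := by
      rw [← mul_assoc, mul_assoc Q, hz2]
    have h2 : Q * E * star E = E * star E := by rw [mul_assoc, hz2]
    rw [h1, h2, ← mul_assoc E, sub_self, map_zero]
  have hQQ : Q * Q = Q := by
    rw [show Q * Q = Q * (E * star E) * z by rw [hQ]; simp only [mul_assoc], hz2]
  have hQ0 : Q = 0 := by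
    refine hτ.eq_zero ?_
    rw [hz1, hQQ, ← hEQ, htr, hQE, h0]
  rw [← hQE, hQ0, zero_mul]

/-- Write the minimal polynomial as X^k g with X not dividing g. Bézout for X^(k+1) and g gives an
idempotent E, a polynomial in z without constant term, with E z^k = z^k. Its trace vanishes, so E =
0 and z^k = 0. -/
lemma exists_pow_eq_zero (hτ : IsFaithfulPositive τ) (htr : ∀ x y, τ (x * y) = τ (y * x)) {z : R}
    (h0 : ∀ n : ℕ, τ (z ^ (n + 1)) = 0) : ∃ n : ℕ, z ^ n = 0 := by
  have hp : minpoly ℂ z ≠ 0 := minpoly.ne_zero (Algebra.IsIntegral.isIntegral z)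
  obtain ⟨g, hg, hdvd⟩ := Polynomial.exists_eq_pow_rootMultiplicity_mul_and_not_dvd _ hp 0
  set k := (minpoly ℂ z).rootMultiplicity 0
  rw [Polynomial.C_0, sub_zero] at hg hdvd
  have hcop : IsCoprime (Polynomial.X ^ (k + 1)) g :=
    IsCoprime.pow_left ((Polynomial.irreducible_X.coprime_iff_not_dvd).2 hdvd)
  obtain ⟨u, v, huv⟩ := hcop
  obtain ⟨E, hE⟩ : ∃ E, E = Polynomial.aeval z u * z ^ (k + 1) := ⟨_, rfl⟩
  have hEz : E * z ^ k = z ^ k := by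
    have h1 : u * Polynomial.X ^ (k + 1) * Polynomial.X ^ k + v * minpoly ℂ z =
        Polynomial.X ^ k := by
      rw [hg]
      linear_combination Polynomial.X ^ k * huv
    have h2 := congrArg (Polynomial.aeval z) h1
    simpa [hE] using h2
  have hEE : E * E = E := by
    have hc : Commute E (Polynomial.aeval z u) := by
      have : E = Polynomial.aeval z (u * Polynomial.X ^ (k + 1)) := by simp [hE]
      rw [this, commute_iff_eq, ← map_mul, ← map_mul, mul_comm]
    calc E * E = E * (Polynomial.aeval z u * (z ^ k * z)) := by rw [← pow_succ, ← hE]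
      _ = E * Polynomial.aeval z u * (z ^ k * z) := by rw [mul_assoc]
      _ = Polynomial.aeval z u * (E * z ^ k) * z := by rw [hc.eq]; simp only [mul_assoc]
      _ = E := by rw [hEz, hE, pow_succ]; simp only [mul_assoc]
  have hpoly : ∀ q : Polynomial ℂ, τ (Polynomial.aeval z (q * Polynomial.X)) = 0 := by
    intro q
    induction q using Polynomial.induction_on' with
    | add p q hp hq => rw [add_mul, map_add, map_add, hp, hq, add_zero]
    | monomial n a =>
      rw [Polynomial.monomial_mul_X, Polynomial.aeval_monomial, ← Algebra.smul_def, map_smul, h0,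
        smul_zero]
  have hE0 : τ E = 0 := by
    have := hpoly (u * Polynomial.X ^ k)
    rwa [mul_assoc, ← pow_succ, map_mul, map_pow, Polynomial.aeval_X, ← hE] at this
  refine ⟨k, ?_⟩
  rw [← hEz, hτ.eq_zero_of_idempotent htr hEE hE0, zero_mul]

end IsFaithfulPositive

end

namespace UnitaryFusion

open UnitaryStructure
open scoped ComplexOrder

/-! ### Dagger calculus and scalars of the tensor unit -/

section Dagger

variable {B : Type u} [Category.{v} B] [MonoidalCategory B] [Abelian B] [Linear ℂ B]
  [UnitaryStructure B]

attribute [simp] UnitaryStructure.dag_dag UnitaryStructure.dag_comp UnitaryStructure.dag_add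
  UnitaryStructure.dag_smul UnitaryStructure.dag_tensor UnitaryStructure.dag_associator
  UnitaryStructure.dag_leftUnitor UnitaryStructure.dag_rightUnitor

@[simp]
lemma dag_id (X : B) : dag (𝟙 X) = 𝟙 X := by
  have h := dag_comp (𝟙 X) (dag (𝟙 X))
  rw [Category.id_comp, dag_dag, Category.id_comp] at h
  exact h.symm

@[simp]
lemma dag_whiskerLeft (X : B) {Y Z : B} (f : Y ⟶ Z) : dag (X ◁ f) = X ◁ dag f := by
  rw [← id_tensorHom, dag_tensor, dag_id, id_tensorHom]

@[simp]
lemma dag_whiskerRight {Y Z : B} (f : Y ⟶ Z) (X : B) : dag (f ▷ X) = dag f ▷ X := by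
  rw [← tensorHom_id, dag_tensor, dag_id, tensorHom_id]

@[simp]
lemma dag_associator_inv (X Y Z : B) : dag (α_ X Y Z).inv = (α_ X Y Z).hom := by
  rw [← dag_associator, dag_dag]

@[simp]
lemma dag_leftUnitor_inv (X : B) : dag (λ_ X).inv = (λ_ X).hom := by
  rw [← dag_leftUnitor, dag_dag]

@[simp]
lemma dag_rightUnitor_inv (X : B) : dag (ρ_ X).inv = (ρ_ X).hom := by
  rw [← dag_rightUnitor, dag_dag]

@[simp]
lemma dag_zero (X Y : B) : dag (0 : X ⟶ Y) = 0 := by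
  simpa using dag_smul (0 : ℂ) (0 : X ⟶ Y)

@[simp]
lemma dag_neg {X Y : B} (f : X ⟶ Y) : dag (-f) = -dag f := by
  simpa using dag_smul (-1 : ℂ) f

@[simp]
lemma dag_sub {X Y : B} (f g : X ⟶ Y) : dag (f - g) = dag f - dag g := by
  rw [sub_eq_add_neg, dag_add, dag_neg, ← sub_eq_add_neg]

lemma dag_injective {X Y : B} : Function.Injective (dag : (X ⟶ Y) → (Y ⟶ X)) :=
  fun f g h => by rw [← dag_dag f, h, dag_dag]

@[simp]
lemma dag_eq_zero {X Y : B} {f : X ⟶ Y} : dag f = 0 ↔ f = 0 :=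
  ⟨fun h => dag_injective (by rw [h, dag_zero]), fun h => by rw [h, dag_zero]⟩

instance endStarRing (X : B) : StarRing (End X) where
  star f := dag f
  star_involutive f := dag_dag f
  star_mul f g := dag_comp g f
  star_add f g := dag_add f g

instance endStarModule (X : B) : StarModule ℂ (End X) where
  star_smul c f := dag_smul c f

lemma end_star_eq {X : B} (f : End X) : star f = dag f := rfl

end Dagger

section Fusion

variable {B : Type u} [Category.{v} B] [MonoidalCategory B] [Abelian B] [Linear ℂ B]
  [MonoidalPreadditive B] [MonoidalLinear ℂ B] [RigidCategory B] [IsFusionCategory B]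

instance finiteDimensional_hom (X Y : B) : FiniteDimensional ℂ (X ⟶ Y) :=
  IsFusionCategory.finite_hom X Y

instance finiteDimensional_end (X : B) : FiniteDimensional ℂ (End X) :=
  IsFusionCategory.finite_hom X X

lemma unitScalar_smul_id (c : ℂ) : unitScalar B (c • 𝟙 (𝟙_ B)) = c :=
  (LinearEquiv.ofBijective _ (unit_scalar_bijective (B := B))).symm_apply_apply c

lemma unitScalar_spec (f : 𝟙_ B ⟶ 𝟙_ B) : unitScalar B f • 𝟙 (𝟙_ B) = f :=
  (LinearEquiv.ofBijective _ (unit_scalar_bijective (B := B))).apply_symm_apply f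

variable [UnitaryStructure B]

/-- By `dag_positive` the scalar has the form g g† with g in End 1 = ℂ, that is |g|². -/
lemma unitScalar_pos {Y : B} (z : 𝟙_ B ⟶ Y) (hz : z ≠ 0) : 0 < unitScalar B (z ≫ dag z) := by
  obtain ⟨g, hg⟩ := dag_positive z
  have hne : z ≫ dag z ≠ 0 := fun h => hz (dag_definite z h)
  rw [hg, ← unitScalar_spec g] at *
  rw [dag_smul, dag_id, Linear.smul_comp, Linear.comp_smul, Category.id_comp, smul_smul,
    unitScalar_smul_id] at *
  have hc : unitScalar B g ≠ 0 := by
    intro h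
    rw [h] at hne
    simp at hne
  rw [mul_comm, ← Complex.normSq_eq_conj_mul_self]
  exact_mod_cast Complex.normSq_pos.2 hc

end Fusion

/-! ### Exact pairings and mates -/

section Pairing

variable {C : Type u} [Category.{v} C] [MonoidalCategory C]

open ExactPairing

lemma coevaluation_whiskerRight_injective {X D Z : C} (p : ExactPairing X D) {f g : X ⟶ Z}
    (h : p.coevaluation' ≫ f ▷ D = p.coevaluation' ≫ g ▷ D) : f = g := by
  have h' : tensorRightHomEquiv (𝟙_ C) X D Z ((λ_ X).hom ≫ f) =
      tensorRightHomEquiv (𝟙_ C) X D Z ((λ_ X).hom ≫ g) := by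
    have key : ∀ f : X ⟶ Z, tensorRightHomEquiv (𝟙_ C) X D Z ((λ_ X).hom ≫ f) =
        p.coevaluation' ≫ f ▷ D := fun f => by
      change (ρ_ _).inv ≫ _ ◁ η_ X D ≫ (α_ _ _ _).inv ≫ ((λ_ X).hom ≫ f) ▷ _ = η_ X D ≫ _
      monoidal
    rw [key, key, h]
  simpa using (tensorRightHomEquiv (𝟙_ C) X D Z).injective h'

lemma whiskerLeft_evaluation_injective {X D Z : C} (p : ExactPairing X D) {f g : Z ⟶ X}
    (h : D ◁ f ≫ p.evaluation' = D ◁ g ≫ p.evaluation') : f = g := by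
  have h' : (tensorLeftHomEquiv Z X D (𝟙_ C)).symm (f ≫ (ρ_ X).inv) =
      (tensorLeftHomEquiv Z X D (𝟙_ C)).symm (g ≫ (ρ_ X).inv) := by
    have key : ∀ f : Z ⟶ X, (tensorLeftHomEquiv Z X D (𝟙_ C)).symm (f ≫ (ρ_ X).inv) =
        D ◁ f ≫ p.evaluation' := fun f => by
      change D ◁ (f ≫ (ρ_ X).inv) ≫ (α_ _ _ _).inv ≫ ε_ X D ▷ _ ≫ (λ_ _).hom = _ ≫ ε_ X D
      monoidal
    rw [key, key, h]
  simpa using (tensorLeftHomEquiv Z X D (𝟙_ C)).symm.injective h'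

lemma exists_mate {X Y DX DY : C} (p : ExactPairing X DX) (q : ExactPairing Y DY) (f : X ⟶ Y) :
    ∃ f' : DY ⟶ DX, q.coevaluation' ≫ Y ◁ f' = p.coevaluation' ≫ f ▷ DX ∧
      f' ▷ X ≫ p.evaluation' = DY ◁ f ≫ q.evaluation' := by
  let _ : HasRightDual X := ⟨DX⟩
  let _ : HasRightDual Y := ⟨DY⟩
  exact ⟨fᘁ, coevaluation_comp_rightAdjointMate f, rightAdjointMate_comp_evaluation f⟩

lemma exists_of_mate {X Y DX DY : C} (p : ExactPairing X DX) (q : ExactPairing Y DY)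
    (f : DY ⟶ DX) :
    ∃ k : X ⟶ Y, q.coevaluation' ≫ Y ◁ f = p.coevaluation' ≫ k ▷ DX ∧
      f ▷ X ≫ p.evaluation' = DY ◁ k ≫ q.evaluation' := by
  let _ : HasLeftDual DX := ⟨X⟩
  let _ : HasLeftDual DY := ⟨Y⟩
  exact ⟨ᘁf, (coevaluation_comp_leftAdjointMate f).symm, (leftAdjointMate_comp_evaluation f).symm⟩

end Pairing

/-! ### Standard duals and the canonical trace -/

section Traces

variable {B : Type u} [Category.{v} B] [MonoidalCategory B] [Abelian B] [Linear ℂ B]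
  [MonoidalPreadditive B] [MonoidalLinear ℂ B] [RigidCategory B] [IsFusionCategory B]
  [UnitaryStructure B]

lemma unitScalar_injective : Function.Injective (unitScalar B) :=
  (LinearEquiv.ofBijective _ (unit_scalar_bijective (B := B))).symm.injective

/-- The right trace of an exact pairing. -/
noncomputable def rightTrace {X D : B} (p : ExactPairing X D) : (X ⟶ X) →ₗ[ℂ] ℂ :=
  unitScalar B ∘ₗ
    { toFun := fun f => p.coevaluation' ≫ (f ▷ D) ≫ dag p.coevaluation'
      map_add' := fun f g => by simp
      map_smul' := fun c f => by simp }

/-- The left trace of an exact pairing. -/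
noncomputable def leftTrace {X D : B} (p : ExactPairing X D) : (X ⟶ X) →ₗ[ℂ] ℂ :=
  unitScalar B ∘ₗ
    { toFun := fun f => dag p.evaluation' ≫ (D ◁ f) ≫ p.evaluation'
      map_add' := fun f g => by simp
      map_smul' := fun c f => by simp }

lemma rightTrace_apply {X D : B} (p : ExactPairing X D) (f : X ⟶ X) :
    rightTrace p f = unitScalar B (p.coevaluation' ≫ (f ▷ D) ≫ dag p.coevaluation') := rfl

lemma leftTrace_apply {X D : B} (p : ExactPairing X D) (f : X ⟶ X) :
    leftTrace p f = unitScalar B (dag p.evaluation' ≫ (D ◁ f) ≫ p.evaluation') := rfl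

lemma rightTrace_pos {X Y D : B} (p : ExactPairing X D) (f : X ⟶ Y) (hf : f ≠ 0) :
    0 < rightTrace p (f ≫ dag f) := by
  have := unitScalar_pos (p.coevaluation' ≫ f ▷ D) fun h =>
    hf (coevaluation_whiskerRight_injective p (by simpa using h))
  simpa [rightTrace_apply] using this

lemma leftTrace_pos {X Y D : B} (p : ExactPairing X D) (f : X ⟶ Y) (hf : f ≠ 0) :
    0 < leftTrace p (f ≫ dag f) := by
  have := unitScalar_pos (dag p.evaluation' ≫ D ◁ f) fun h => hf <| by
    have h1 := congrArg dag h
    rw [dag_comp, dag_whiskerLeft, dag_dag, dag_zero] at h1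
    simpa using whiskerLeft_evaluation_injective p (f := dag f) (g := 0) (by simpa using h1)
  simpa [leftTrace_apply] using this

lemma isFaithfulPositive_rightTrace {X D : B} (p : ExactPairing X D) :
    IsFaithfulPositive (R := End X) (rightTrace p) := fun x hx => rightTrace_pos p x hx

lemma isFaithfulPositive_leftTrace {X D : B} (p : ExactPairing X D) :
    IsFaithfulPositive (R := End X) (leftTrace p) := fun x hx => leftTrace_pos p x hx

/-- Every object of a unitary fusion category has a standard dual. -/
theorem nonempty_standardDual (X : B) : Nonempty (StandardDual X) := by
  let p : ExactPairing X (HasRightDual.rightDual X) := inferInstance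
  -- Twisting the pairing by an automorphism h of X conjugates the left trace by h and the right
  -- trace by h⁻¹.
  obtain ⟨h, hh⟩ := (isFaithfulPositive_leftTrace p).exists_balancing
    (isFaithfulPositive_rightTrace p)
  let i : X ≅ X := ⟨(h : End X), ((h⁻¹ : (End X)ˣ) : End X),
    h.inv_mul, h.mul_inv⟩
  refine ⟨⟨HasRightDual.rightDual X, exactPairingCongrLeft i, fun f => ?_⟩⟩
  apply unitScalar_injective
  have h1 : leftTrace p (dag i.hom ≫ f ≫ i.hom) = rightTrace p (i.inv ≫ f ≫ dag i.inv) := by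
    exact hh f
  rw [leftTrace_apply, rightTrace_apply] at h1
  change unitScalar B (dag (_ ◁ i.hom ≫ p.evaluation') ≫ _ ◁ f ≫ _ ◁ i.hom ≫ p.evaluation') =
    unitScalar B ((p.coevaluation' ≫ i.inv ▷ _) ≫ f ▷ _ ≫ dag (p.coevaluation' ≫ i.inv ▷ _))
  simpa using h1

namespace StandardDual

/-- The trace of a standard dual. -/
noncomputable def tr {X : B} (S : StandardDual X) : (X ⟶ X) →ₗ[ℂ] ℂ := rightTrace S.pairing

lemma leftTrace_eq {X : B} (S : StandardDual X) : leftTrace S.pairing = S.tr := by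
  ext f
  rw [leftTrace_apply, S.balanced]
  rfl

/-- The trace is cyclic, for any choice of standard duals. -/
theorem tr_comm {X Y : B} (S : StandardDual X) (S' : StandardDual Y) (f : X ⟶ Y) (g : Y ⟶ X) :
    S.tr (f ≫ g) = S'.tr (g ≫ f) := by
  -- Moving f around the loop replaces it by k†, obtained from f by taking the mate, the dagger and
  -- the mate back; the claim reduces to k† = f.
  obtain ⟨f', hf1, hf2⟩ := exists_mate S.pairing S'.pairing f
  obtain ⟨k, hk1, hk2⟩ := exists_of_mate S'.pairing S.pairing (dag f')
  have h1 : ∀ g : Y ⟶ X, S'.tr (g ≫ f) = S.tr (dag k ≫ g) := by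
    intro g
    rw [← leftTrace_eq, ← leftTrace_eq, leftTrace_apply, leftTrace_apply]
    have e : dag S'.pairing.evaluation' ≫ f' ▷ Y =
        dag S.pairing.evaluation' ≫ S.dual ◁ dag k := by
      apply dag_injective
      simpa using hk2
    rw [MonoidalCategory.whiskerLeft_comp, Category.assoc, ← hf2, whisker_exchange_assoc,
      reassoc_of% e, MonoidalCategory.whiskerLeft_comp, Category.assoc]
  have h2 : ∀ g : Y ⟶ X, S.tr (f ≫ g) = S'.tr (g ≫ dag k) := by
    intro g
    change rightTrace _ _ = rightTrace _ _
    rw [rightTrace_apply, rightTrace_apply]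
    have e : X ◁ f' ≫ dag S.pairing.coevaluation' =
        dag k ▷ S'.dual ≫ dag S'.pairing.coevaluation' := by
      apply dag_injective
      simpa using hk1
    rw [comp_whiskerRight, Category.assoc, ← reassoc_of% hf1, whisker_exchange_assoc, e,
      comp_whiskerRight, Category.assoc]
  -- For δ = k† - f the two rotations give tr(g ≫ δ) = -tr(δ ≫ g). At g = δ† both traces are
  -- positive unless δ = 0.
  have h3 : dag k - f = 0 := by
    by_contra hne
    have p1 := rightTrace_pos S.pairing _ hne
    have p2 := rightTrace_pos S'.pairing (dag (dag k - f)) fun h => hne (dag_eq_zero.1 h)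
    have e : ∀ g : Y ⟶ X, S'.tr (g ≫ (dag k - f)) = - S.tr ((dag k - f) ≫ g) := by
      intro g
      rw [Preadditive.comp_sub, Preadditive.sub_comp, map_sub, map_sub, ← h2, h1]
      ring
    rw [dag_dag] at p2
    have := e (dag (dag k - f))
    change rightTrace _ _ = - rightTrace _ _ at this
    rw [this] at p2
    exact lt_asymm p1 (neg_pos.1 p2)
  rw [h2, sub_eq_zero.1 h3]

end StandardDual

/-- Independence of the chosen dual is cyclicity between two standard duals of one object, with one
factor the identity. -/
lemma trace_eq {X : B} (S : StandardDual X) : trace X = S.tr := by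
  have h : Nonempty (StandardDual X) := ⟨S⟩
  have h1 : trace X = h.some.tr := dif_pos h
  ext f
  simpa [h1] using h.some.tr_comm S f (𝟙 X)

lemma trace_comm {X Y : B} (f : X ⟶ Y) (g : Y ⟶ X) : trace X (f ≫ g) = trace Y (g ≫ f) := by
  obtain ⟨S⟩ := nonempty_standardDual X
  obtain ⟨S'⟩ := nonempty_standardDual Y
  rw [trace_eq S, trace_eq S', S.tr_comm S']

lemma trace_pos {X Y : B} (f : X ⟶ Y) (hf : f ≠ 0) : 0 < trace X (f ≫ dag f) := by
  obtain ⟨S⟩ := nonempty_standardDual X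
  rw [trace_eq S]
  exact rightTrace_pos _ f hf

lemma isFaithfulPositive_trace (X : B) : IsFaithfulPositive (R := End X) (trace X) :=
  fun f hf => trace_pos f hf

/-- The right partial trace. -/
noncomputable def rightPartialTrace {Y D : B} (p : ExactPairing Y D) {Z Z' : B}
    (f : Z ⊗ Y ⟶ Z' ⊗ Y) : Z ⟶ Z' :=
  (ρ_ Z).inv ≫ Z ◁ p.coevaluation' ≫ (α_ Z Y D).inv ≫ f ▷ D ≫ (α_ Z' Y D).hom ≫
    Z' ◁ dag p.coevaluation' ≫ (ρ_ Z').hom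

/-- The left partial trace. -/
noncomputable def leftPartialTrace {X D : B} (p : ExactPairing X D) {Z Z' : B}
    (f : X ⊗ Z ⟶ X ⊗ Z') : Z ⟶ Z' :=
  (λ_ Z).inv ≫ dag p.evaluation' ▷ Z ≫ (α_ D X Z).hom ≫ D ◁ f ≫ (α_ D X Z').inv ≫
    p.evaluation' ▷ Z' ≫ (λ_ Z').hom

lemma tensor_coevaluation' {X Y DX DY : B} (p : ExactPairing X DX) (q : ExactPairing Y DY) :
    (ExactPairing.tensor : ExactPairing (X ⊗ Y) (DY ⊗ DX)).coevaluation' =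
      p.coevaluation' ≫ ((ρ_ X).inv ≫ X ◁ q.coevaluation' ≫ (α_ X Y DY).inv) ▷ DX ≫
        (α_ (X ⊗ Y) DY DX).hom := by
  change ExactPairing.coevaluation (X ⊗ Y) (DY ⊗ DX) = ExactPairing.coevaluation X DX ≫
    ((ρ_ X).inv ≫ X ◁ ExactPairing.coevaluation Y DY ≫ (α_ X Y DY).inv) ▷ DX ≫ _
  rw [ExactPairing.tensor_coevaluation]
  monoidal

lemma tensor_evaluation' {X Y DX DY : B} (p : ExactPairing X DX) (q : ExactPairing Y DY) :
    (ExactPairing.tensor : ExactPairing (X ⊗ Y) (DY ⊗ DX)).evaluation' =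
      (α_ DY DX (X ⊗ Y)).hom ≫ DY ◁ ((α_ DX X Y).inv ≫ p.evaluation' ▷ Y ≫ (λ_ Y).hom) ≫
        q.evaluation' := by
  change ExactPairing.evaluation (X ⊗ Y) (DY ⊗ DX) = _ ≫
    DY ◁ (_ ≫ ExactPairing.evaluation X DX ▷ _ ≫ _) ≫ ExactPairing.evaluation Y DY
  rw [ExactPairing.tensor_evaluation]
  monoidal

lemma rightTrace_tensor {X Y DX DY : B} (p : ExactPairing X DX) (q : ExactPairing Y DY)
    (f : X ⊗ Y ⟶ X ⊗ Y) :
    rightTrace (ExactPairing.tensor : ExactPairing (X ⊗ Y) (DY ⊗ DX)) f =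
      rightTrace p (rightPartialTrace q f) := by
  rw [rightTrace_apply, rightTrace_apply, tensor_coevaluation', rightPartialTrace]
  congr 1
  simp only [dag_comp, dag_whiskerRight, dag_whiskerLeft, dag_rightUnitor_inv,
    dag_associator_inv, dag_associator]
  monoidal

lemma leftTrace_tensor {X Y DX DY : B} (p : ExactPairing X DX) (q : ExactPairing Y DY)
    (f : X ⊗ Y ⟶ X ⊗ Y) :
    leftTrace (ExactPairing.tensor : ExactPairing (X ⊗ Y) (DY ⊗ DX)) f =
      leftTrace q (leftPartialTrace p f) := by
  rw [leftTrace_apply, leftTrace_apply, tensor_evaluation', leftPartialTrace]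
  congr 1
  simp only [dag_comp, dag_whiskerRight, dag_whiskerLeft, dag_leftUnitor,
    dag_associator_inv, dag_associator]
  monoidal

/-- The loops on X and on Y are closed on opposite sides of f, so the interchange law lets either be
closed first. This is what makes standard duals stable under tensor products. -/
lemma leftTrace_rightPartialTrace {X Y DX DY : B} (p : ExactPairing X DX) (q : ExactPairing Y DY)
    (f : X ⊗ Y ⟶ X ⊗ Y) :
    leftTrace p (rightPartialTrace q f) = rightTrace q (leftPartialTrace p f) := by
  rw [leftTrace_apply, rightTrace_apply, rightPartialTrace, leftPartialTrace]
  congr 1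
  generalize q.coevaluation' = c, p.evaluation' = e, dag q.coevaluation' = c', dag p.evaluation' = e'
  calc _ = 𝟙 _ ⊗≫ (e' ▷ 𝟙_ B ≫ (DX ⊗ X) ◁ c) ⊗≫ DX ◁ f ▷ DY ⊗≫
        ((DX ⊗ X) ◁ c' ≫ e ▷ 𝟙_ B) ⊗≫ 𝟙 _ := by monoidal
    _ = 𝟙 _ ⊗≫ (𝟙_ B ◁ c ≫ e' ▷ (Y ⊗ DY)) ⊗≫ DX ◁ f ▷ DY ⊗≫
        (e ▷ (Y ⊗ DY) ≫ 𝟙_ B ◁ c') ⊗≫ 𝟙 _ := by rw [whisker_exchange, whisker_exchange]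
    _ = _ := by monoidal

/-- The standard dual of a tensor product. -/
noncomputable def StandardDual.tensor {X Y : B} (S : StandardDual X) (S' : StandardDual Y) :
    StandardDual (X ⊗ Y) where
  dual := S'.dual ⊗ S.dual
  pairing := @ExactPairing.tensor _ _ _ _ _ _ _ S.pairing S'.pairing
  balanced f := by
    apply unitScalar_injective
    have h := leftTrace_rightPartialTrace S.pairing S'.pairing f
    rw [S.leftTrace_eq, ← StandardDual.tr, ← S'.leftTrace_eq, StandardDual.tr,
      ← rightTrace_tensor, ← leftTrace_tensor] at h
    exact h.symm

lemma trace_tensor {X Y : B} (S' : StandardDual Y) (f : X ⊗ Y ⟶ X ⊗ Y) :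
    trace (X ⊗ Y) f = trace X (rightPartialTrace S'.pairing f) := by
  obtain ⟨S⟩ := nonempty_standardDual X
  rw [trace_eq S, trace_eq (S.tensor S')]
  exact rightTrace_tensor _ _ f

end Traces

/-! ### Convolution on End A, isometry as multiplicativity, and the separable case -/

open scoped MonObj

/-- Expand x as a sum of v_i ⊗ b_i over a basis of W and test against v_j ⊗ w'_j for a family w'
dual to the basis; only β(v_j, v_j) survives. -/
lemma eq_zero_of_tensorForm {V W : Type*} [AddCommGroup V] [Module ℂ V] [AddCommGroup W]
    [Module ℂ W] [FiniteDimensional ℂ W] {β : V →ₗ⋆[ℂ] V →ₗ[ℂ] ℂ} {β' : W →ₗ⋆[ℂ] W →ₗ[ℂ] ℂ}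
    (hβ : ∀ v, β v v = 0 → v = 0) (hβ' : ∀ w, β' w w = 0 → w = 0) {x : V ⊗[ℂ] W}
    (hx : ∀ y, tensorForm β β' x y = 0) : x = 0 := by
  let b := Module.finBasis ℂ W
  let L : W →ₗ[ℂ] (Fin (Module.finrank ℂ W) → ℂ) := LinearMap.pi fun i => β' (b i)
  have hL : Function.Injective L := by
    rw [injective_iff_map_eq_zero]
    intro w hw
    have h1 : ∀ i, β' (b i) w = 0 := fun i => congrFun hw i
    refine hβ' w ?_
    have h2 : β' (∑ i, b.repr w i • b i) w = 0 := by
      rw [map_sum, LinearMap.sum_apply]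
      exact Finset.sum_eq_zero fun i _ => by
        rw [LinearMap.map_smulₛₗ, LinearMap.smul_apply, h1, smul_zero]
    rwa [b.sum_repr] at h2
  have hsurj := (LinearMap.injective_iff_surjective_of_finrank_eq_finrank (by simp)).1 hL
  choose w' hw' using fun j => hsurj (Pi.single j 1)
  have hw : ∀ i j, β' (b i) (w' j) = (Pi.single j 1 : Fin _ → ℂ) i := fun i j => congrFun (hw' j) i
  let c := TensorProduct.equivFinsuppOfBasisRight (M := V) b
  have hxe : x = c.symm (c x) := (c.symm_apply_apply x).symm
  obtain ⟨v, hv⟩ : ∃ v : Fin (Module.finrank ℂ W) → V, x = ∑ i, v i ⊗ₜ[ℂ] b i := by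
    refine ⟨fun i => c x i, ?_⟩
    nth_rewrite 1 [hxe]
    rw [TensorProduct.equivFinsuppOfBasisRight_symm_apply, Finsupp.sum_fintype _ _ (by simp)]
  have hz : ∀ j, v j = 0 := by
    intro j
    refine hβ _ ?_
    have := hx (v j ⊗ₜ w' j)
    rw [hv] at this
    simpa [tensorForm_tmul, hw, Pi.single_apply] using this
  rw [hv]
  simp [hz]

section Algebra

variable {B : Type u} [Category.{v} B] [MonoidalCategory B] [Abelian B] [Linear ℂ B]
  [MonoidalPreadditive B] [MonoidalLinear ℂ B] [RigidCategory B] [IsFusionCategory B]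
  [UnitaryStructure B]

/-- Every morphism is von Neumann regular. -/
lemma exists_regular {X Y : B} (g : X ⟶ Y) : ∃ w : Y ⟶ X, g ≫ w ≫ g = g := by
  obtain ⟨z, -, hz⟩ := (isFaithfulPositive_trace Y).exists_range_projection
    (R := End Y) (h := dag g ≫ g) (by simp [end_star_eq])
  have hz : (dag g ≫ g) ≫ z ≫ dag g ≫ g = dag g ≫ g := hz
  -- z is a generalized inverse of the self-adjoint `dag g ≫ g`; definiteness of the dagger then
  -- cancels the extra `dag g`.
  refine ⟨z ≫ dag g, ?_⟩
  rw [← sub_eq_zero, ← dag_eq_zero]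
  refine dag_definite _ ?_
  rw [dag_dag]
  have h0 : dag g ≫ (g ≫ (z ≫ dag g) ≫ g - g) = 0 := by
    rw [Preadditive.comp_sub, sub_eq_zero]
    simpa using hz
  rw [show dag (g ≫ (z ≫ dag g) ≫ g - g) = dag ((z ≫ dag g) ≫ g - 𝟙 Y) ≫ dag g by
    rw [← dag_comp, Preadditive.comp_sub, Category.comp_id], Category.assoc, h0, Limits.comp_zero]

variable (A : B) [MonObj A]

/-- The convolution product on the endomorphisms of an algebra. -/
noncomputable def convolution : (A ⟶ A) →ₗ[ℂ] (A ⟶ A) →ₗ[ℂ] (A ⟶ A) :=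
  LinearMap.mk₂ ℂ (fun F G => dag μ[A] ≫ (F ⊗ₘ G) ≫ μ[A])
    (fun f f' g => by simp [MonoidalCategory.tensorHom_def])
    (fun c f g => by simp [MonoidalCategory.tensorHom_def])
    (fun f g g' => by simp [MonoidalCategory.tensorHom_def])
    (fun c f g => by simp [MonoidalCategory.tensorHom_def])

lemma convolution_apply (F G : A ⟶ A) :
    convolution A F G = dag μ[A] ≫ (F ⊗ₘ G) ≫ μ[A] := rfl

lemma one_convolution (F : A ⟶ A) : convolution A (dag η[A] ≫ η[A]) F = F := by
  have h : dag μ[A] ≫ dag η[A] ▷ A = (λ_ A).inv := by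
    apply dag_injective
    simp
  rw [convolution_apply, MonoidalCategory.tensorHom_def, comp_whiskerRight]
  simp only [Category.assoc]
  rw [reassoc_of% h, ← whisker_exchange_assoc, MonObj.one_mul]
  simp

lemma convolution_assoc (F G H : A ⟶ A) : convolution A (convolution A F G) H =
    convolution A F (convolution A G H) := by
  have h : dag μ[A] ≫ dag μ[A] ▷ A = dag μ[A] ≫ A ◁ dag μ[A] ≫ (α_ A A A).inv := by
    apply dag_injective
    simp
  have h1 : convolution A (convolution A F G) H =
      (dag μ[A] ≫ dag μ[A] ▷ A) ≫ ((F ⊗ₘ G) ⊗ₘ H) ≫ μ[A] ▷ A ≫ μ[A] := by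
    rw [convolution_apply, convolution_apply]
    simp only [MonoidalCategory.tensorHom_def, comp_whiskerRight, Category.assoc,
      whisker_exchange_assoc]
  have h2 : convolution A F (convolution A G H) =
      dag μ[A] ≫ A ◁ dag μ[A] ≫ (F ⊗ₘ (G ⊗ₘ H)) ≫ A ◁ μ[A] ≫ μ[A] := by
    rw [convolution_apply, convolution_apply]
    simp only [MonoidalCategory.tensorHom_def', MonoidalCategory.whiskerLeft_comp, Category.assoc,
      ← whisker_exchange_assoc]
  rw [h1, h2, h, MonObj.mul_assoc]
  simp

lemma convolution_pos {X Y : B} (x : A ⟶ X) (y : A ⟶ Y) :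
    convolution A (x ≫ dag x) (y ≫ dag y) =
      (dag μ[A] ≫ (x ⊗ₘ y)) ≫ dag (dag μ[A] ≫ (x ⊗ₘ y)) := by
  rw [convolution_apply]
  simp

variable {A}

lemma homForm_eq (T : A ≅ A) {c : B} (f g : c ⟶ A) :
    homForm T c f g = trace A ((dag f ≫ g) ≫ T.hom ≫ dag T.hom) := by
  change trace c ((g ≫ T.hom) ≫ dag (f ≫ T.hom)) = _
  rw [dag_comp, ← Category.assoc, trace_comm]
  simp

lemma homForm_mulHom (T : A ≅ A) {a b : B} (f g : a ⟶ A) (f' g' : b ⟶ A) :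
    homForm T (a ⊗ b) (mulHom A a b (f ⊗ₜ f')) (mulHom A a b (g ⊗ₜ g')) =
      trace A (convolution A (dag f ≫ g) (dag f' ≫ g') ≫ T.hom ≫ dag T.hom) := by
  rw [homForm_eq, convolution_apply]
  change trace A ((dag ((f ⊗ₘ f') ≫ μ[A]) ≫ ((g ⊗ₘ g') ≫ μ[A])) ≫ _) = _
  simp

lemma homForm_definite (T : A ≅ A) {c : B} (f : c ⟶ A) (h : homForm T c f f = 0) : f = 0 := by
  by_contra hf
  refine (trace_pos (f ≫ T.hom) fun h0 => hf ?_).ne' h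
  rw [← Category.comp_id f, ← T.hom_inv_id, reassoc_of% h0, Limits.zero_comp]

/-- The multiplication maps are isometric as soon as the functional given by `T† T` is
multiplicative for the convolution product. -/
lemma isPartialIsometry_mulHom (T : A ≅ A)
    (hT : ∀ F G : A ⟶ A, trace A (convolution A F G ≫ T.hom ≫ dag T.hom) =
      trace A (F ≫ T.hom ≫ dag T.hom) * trace A (G ≫ T.hom ≫ dag T.hom)) (a b : B) :
    IsPartialIsometry (tensorForm (homForm T a) (homForm T b)) (homForm T (a ⊗ b))
      (mulHom A a b) ∧ Function.Injective (mulHom A a b) := by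
  have key : ∀ x y, homForm T (a ⊗ b) (mulHom A a b x) (mulHom A a b y) =
      tensorForm (homForm T a) (homForm T b) x y := by
    intro x y
    induction x using TensorProduct.induction_on with
    | zero => simp
    | add x x' hx hx' => simp only [map_add, LinearMap.add_apply, hx, hx']
    | tmul f f' =>
      induction y using TensorProduct.induction_on with
      | zero => simp
      | add y y' hy hy' => simp only [map_add, hy, hy']
      | tmul g g' => rw [homForm_mulHom, tensorForm_tmul, homForm_eq, homForm_eq, hT]
  refine ⟨fun x y _ _ => key x y, ?_⟩
  rw [injective_iff_map_eq_zero]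
  intro x hx
  refine eq_zero_of_tensorForm (homForm_definite T) (homForm_definite T) fun y => ?_
  rw [← key, hx, map_zero, LinearMap.zero_apply]

lemma exists_smul_one (hA : IsConnectedAlgebra A) (hne : η[A] ≠ 0) (f : 𝟙_ B ⟶ A) :
    ∃ c : ℂ, c • η[A] = f :=
  (finrank_eq_one_iff_of_nonzero' η[A] hne).1 hA f

lemma one_ne_zero_of_connected (hA : IsConnectedAlgebra A) : η[A] ≠ 0 := by
  intro h
  have h0 : ∀ f : 𝟙_ B ⟶ A, f = 0 := fun f => by
    have h1 : f ≫ (λ_ A).inv ≫ η[A] ▷ A ≫ μ[A] = f := by simp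
    rw [← h1, h]
    simp
  have : Subsingleton (𝟙_ B ⟶ A) := ⟨fun f g => by rw [h0 f, h0 g]⟩
  have h2 := Module.finrank_zero_of_subsingleton (R := ℂ) (M := 𝟙_ B ⟶ A)
  rw [IsConnectedAlgebra, h2] at hA
  exact zero_ne_one hA

/-- A connected separable algebra has no proper nonzero left ideals. -/
lemma eq_zero_of_left_mul (hA : IsConnectedAlgebra A) (hs : IsSeparableAlgebra A) {Y Z : B}
    {y : Y ⟶ A} {x : A ⟶ Z} (hy : y ≠ 0) (h : A ◁ y ≫ μ[A] ≫ x = 0) : x = 0 := by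
  obtain ⟨s, hs1, hs2, hs3⟩ := hs
  obtain ⟨g, hg⟩ : ∃ g : A ⊗ Y ⟶ A, g = A ◁ y ≫ μ[A] := ⟨_, rfl⟩
  obtain ⟨w, hw⟩ := exists_regular g
  -- The image of g is the left ideal generated by y, and `w ≫ g` is an idempotent onto it.
  -- Averaging with the section s makes it a left-module map Q.
  obtain ⟨Q, hQ⟩ : ∃ Q : A ⟶ A, Q = s ≫ A ◁ (w ≫ g) ≫ μ[A] := ⟨_, rfl⟩
  have hmod : A ◁ Q ≫ μ[A] = μ[A] ≫ Q := by
    rw [hQ, ← reassoc_of% hs2]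
    generalize w ≫ g = q
    simp only [MonoidalCategory.whiskerLeft_comp, Category.assoc]
    rw [MonObj.mul_assoc_flip, associator_inv_naturality_right_assoc, whisker_exchange_assoc]
  obtain ⟨c, hc⟩ := exists_smul_one hA (one_ne_zero_of_connected hA) (η[A] ≫ Q)
  -- A left-module endomorphism of A is right multiplication by its value on the unit, which is a
  -- scalar by connectedness.
  have hQc : Q = c • 𝟙 A := by
    have h1 : (ρ_ A).inv ≫ A ◁ η[A] ≫ μ[A] ≫ Q = Q := by
      rw [MonObj.mul_one_assoc, Iso.inv_hom_id_assoc]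
    rw [← hmod, ← whiskerLeft_comp_assoc, ← hc] at h1
    rw [← h1]
    simp
  have hgs : g ≫ s = s ▷ Y ≫ (α_ A A Y).hom ≫ A ◁ g := by
    rw [hg, Category.assoc, ← hs3, whisker_exchange_assoc]
    simp
  have hgQ : g ≫ Q = g := by
    rw [hQ, reassoc_of% hgs, ← whiskerLeft_comp_assoc, hw, ← reassoc_of% hgs, hs1, Category.comp_id]
  have hg0 : g ≠ 0 := by
    intro h0
    apply hy
    have : (λ_ Y).inv ≫ η[A] ▷ Y ≫ g = y := by
      rw [hg, ← whisker_exchange_assoc, MonObj.one_mul]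
      simp
    rw [← this, h0]
    simp
  have hc1 : c = 1 := by
    rw [hQc, Linear.comp_smul, Category.comp_id] at hgQ
    have : (c - 1) • g = 0 := by rw [sub_smul, hgQ, one_smul, sub_self]
    exact sub_eq_zero.1 ((smul_eq_zero.1 this).resolve_right hg0)
  rw [hc1, one_smul] at hQc
  -- Q is now the identity yet takes values in the ideal, which x annihilates.
  have hgx : A ◁ g ≫ μ[A] ≫ x = 0 := by
    rw [hg, MonoidalCategory.whiskerLeft_comp, Category.assoc, MonObj.mul_assoc_flip_assoc,
      associator_inv_naturality_right_assoc, whisker_exchange_assoc, h]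
    simp
  rw [← Category.id_comp x, ← hQc, hQ]
  simp only [MonoidalCategory.whiskerLeft_comp, Category.assoc, hgx, Limits.comp_zero]

theorem exists_iso_of_isSeparable (hA : IsConnectedAlgebra A) (hs : IsSeparableAlgebra A) :
    ∃ T : A ≅ A, ∀ F G : A ⟶ A, trace A (convolution A F G ≫ T.hom ≫ dag T.hom) =
      trace A (F ≫ T.hom ≫ dag T.hom) * trace A (G ≫ T.hom ≫ dag T.hom) := by
  obtain ⟨T, hT⟩ := (isFaithfulPositive_trace A).exists_multiplicative
    (fun x y => trace_comm (show A ⟶ A from y) (show A ⟶ A from x)) (convolution A)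
    (dag η[A] ≫ η[A]) (one_convolution A) (convolution_assoc A)
    (fun x y => by
      obtain ⟨g, hg⟩ := dag_positive (dag μ[A] ≫ ((show A ⟶ A from x) ⊗ₘ (show A ⟶ A from y)))
      exact ⟨g, (convolution_pos A (show A ⟶ A from x) (show A ⟶ A from y)).trans hg⟩)
    (fun x y hx hy => by
      -- By cyclicity the required quantity is the squared norm of this morphism. Its dagger
      -- vanishes only if x kills the left ideal generated by y†.
      have h1 : dag (show A ⟶ A from x) ≫ dag μ[A] ≫ A ◁ (show A ⟶ A from y) ≠ 0 := fun h0 => by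
        refine hx (eq_zero_of_left_mul hA hs (y := dag (show A ⟶ A from y)) (x := x)
          (fun h => hy (dag_eq_zero.1 h)) (dag_eq_zero.1 ?_))
        simpa using h0
      have h2 := trace_pos _ h1
      simp only [dag_comp, dag_dag, dag_whiskerLeft] at h2
      change 0 < trace A (convolution A (𝟙 A)
        ((show A ⟶ A from y) ≫ dag (show A ⟶ A from y)) ≫
          (show A ⟶ A from x) ≫ dag (show A ⟶ A from x))
      rw [← Category.assoc, trace_comm, convolution_apply]
      simpa using h2)
  refine ⟨⟨(T : End A), ((T⁻¹ : (End A)ˣ) : End A), T.inv_mul, T.mul_inv⟩, fun F G => ?_⟩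
  exact hT F G

end Algebra

/-! ### Frobenius algebras: the comultiplication of a nondegenerate form -/

section Frobenius

variable {C : Type u} [Category.{v} C] [MonoidalCategory C]

open ExactPairing

lemma exists_whiskerRight_evaluation {X D Z : C} (p : ExactPairing X D) (w : Z ⊗ X ⟶ 𝟙_ C) :
    ∃ f : Z ⟶ D, f ▷ X ≫ p.evaluation' = w := by
  obtain ⟨f, hf⟩ := (tensorRightHomEquiv Z X D (𝟙_ C)).symm.surjective w
  refine ⟨f ≫ (λ_ D).hom, ?_⟩
  rw [← hf]
  change _ ≫ ε_ X D = f ▷ X ≫ (α_ _ _ _).hom ≫ _ ◁ ε_ X D ≫ (ρ_ _).hom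
  rw [comp_whiskerRight, Category.assoc, leftUnitor_whiskerRight, Category.assoc,
    ← leftUnitor_naturality, unitors_equal]

lemma whiskerRight_evaluation_injective {X D Z : C} (p : ExactPairing X D) {f g : Z ⟶ D}
    (h : f ▷ X ≫ p.evaluation' = g ▷ X ≫ p.evaluation') : f = g := by
  have h' : (tensorRightHomEquiv Z X D (𝟙_ C)).symm (f ≫ (λ_ D).inv) =
      (tensorRightHomEquiv Z X D (𝟙_ C)).symm (g ≫ (λ_ D).inv) := by
    have key : ∀ f : Z ⟶ D, (tensorRightHomEquiv Z X D (𝟙_ C)).symm (f ≫ (λ_ D).inv) =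
        f ▷ X ≫ p.evaluation' := fun f => by
      change (f ≫ (λ_ D).inv) ▷ X ≫ (α_ _ _ _).hom ≫ _ ◁ ε_ X D ≫ (ρ_ _).hom = _ ≫ ε_ X D
      monoidal
    rw [key, key, h]
  simpa using (tensorRightHomEquiv Z X D (𝟙_ C)).symm.injective h'

variable {A : C} [MonObj A] {t : A ⟶ 𝟙_ C} (P : ExactPairing A A)

/-- The comultiplication of a Frobenius algebra with copairing `P.coevaluation'`. -/
def comul : A ⟶ A ⊗ A :=
  (λ_ A).inv ≫ P.coevaluation' ▷ A ≫ (α_ A A A).hom ≫ A ◁ μ[A]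

/-- Both expressions transpose to the multiplication under the pairing, by associativity and a
zigzag identity. The first form is visibly right-linear, the second left-linear. -/
lemma comul_eq (hP : P.evaluation' = μ[A] ≫ t) :
    comul P = (ρ_ A).inv ≫ A ◁ P.coevaluation' ≫ (α_ A A A).inv ≫ μ[A] ▷ A := by
  have hP : ε_ A A = μ[A] ≫ t := hP
  change (λ_ A).inv ≫ η_ A A ▷ A ≫ (α_ A A A).hom ≫ A ◁ μ[A] =
    (ρ_ A).inv ≫ A ◁ η_ A A ≫ (α_ A A A).inv ≫ μ[A] ▷ A
  apply (tensorRightHomEquiv A A A A).symm.injective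
  have h1 : (tensorRightHomEquiv A A A A).symm
      ((λ_ A).inv ≫ η_ A A ▷ A ≫ (α_ A A A).hom ≫ A ◁ μ[A]) = μ[A] := by
    change (_ ▷ A ≫ (α_ A A A).hom ≫ A ◁ ε_ A A ≫ (ρ_ A).hom) = _
    calc _ = 𝟙 _ ⊗≫ η_ A A ▷ (A ⊗ A) ⊗≫ A ◁ (μ[A] ▷ A ≫ ε_ A A) ⊗≫ 𝟙 _ := by monoidal
      _ = 𝟙 _ ⊗≫ (η_ A A ▷ (A ⊗ A) ≫ (A ⊗ A) ◁ μ[A]) ⊗≫ A ◁ ε_ A A ⊗≫ 𝟙 _ := by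
        rw [hP, MonObj.mul_assoc_assoc, ← hP]; monoidal
      _ = 𝟙 _ ⊗≫ μ[A] ⊗≫ (η_ A A ▷ A ⊗≫ A ◁ ε_ A A) ⊗≫ 𝟙 _ := by
        rw [← whisker_exchange]; monoidal
      _ = μ[A] := by rw [evaluation_coevaluation'']; monoidal
  have h2 : (tensorRightHomEquiv A A A A).symm
      ((ρ_ A).inv ≫ A ◁ η_ A A ≫ (α_ A A A).inv ≫ μ[A] ▷ A) = μ[A] := by
    change (_ ▷ A ≫ (α_ A A A).hom ≫ A ◁ ε_ A A ≫ (ρ_ A).hom) = _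
    calc _ = 𝟙 _ ⊗≫ A ◁ (η_ A A ▷ A) ⊗≫ (μ[A] ▷ (A ⊗ A) ≫ A ◁ ε_ A A) ⊗≫ 𝟙 _ := by monoidal
      _ = 𝟙 _ ⊗≫ A ◁ (η_ A A ▷ A ⊗≫ A ◁ ε_ A A) ⊗≫ μ[A] ⊗≫ 𝟙 _ := by
        rw [← whisker_exchange]; monoidal
      _ = μ[A] := by rw [evaluation_coevaluation'']; monoidal
  rw [h1, h2]

lemma comul_whiskerRight :
    comul P ▷ A ≫ (α_ A A A).hom ≫ A ◁ μ[A] = μ[A] ≫ comul P := by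
  unfold comul
  calc _ = 𝟙 _ ⊗≫ P.coevaluation' ▷ (A ⊗ A) ⊗≫ A ◁ (μ[A] ▷ A ≫ μ[A]) := by monoidal
    _ = 𝟙 _ ⊗≫ (P.coevaluation' ▷ (A ⊗ A) ≫ (A ⊗ A) ◁ μ[A]) ⊗≫ A ◁ μ[A] := by
      rw [MonObj.mul_assoc]; monoidal
    _ = _ := by rw [← whisker_exchange]; monoidal

lemma whiskerLeft_comul (hP : P.evaluation' = μ[A] ≫ t) :
    A ◁ comul P ≫ (α_ A A A).inv ≫ μ[A] ▷ A = μ[A] ≫ comul P := by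
  rw [comul_eq P hP]
  calc _ = 𝟙 _ ⊗≫ (A ⊗ A) ◁ P.coevaluation' ⊗≫ (A ◁ μ[A] ≫ μ[A]) ▷ A := by monoidal
    _ = 𝟙 _ ⊗≫ ((A ⊗ A) ◁ P.coevaluation' ≫ μ[A] ▷ (A ⊗ A)) ⊗≫ μ[A] ▷ A := by
      rw [MonObj.mul_assoc_flip]; monoidal
    _ = _ := by rw [whisker_exchange]; monoidal

lemma comul_counit (hP : P.evaluation' = μ[A] ≫ t) : comul P ≫ A ◁ t ≫ (ρ_ A).hom = 𝟙 A := by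
  have h := P.evaluation_coevaluation'
  rw [hP, MonoidalCategory.whiskerLeft_comp] at h
  unfold comul
  simp only [Category.assoc]
  rw [reassoc_of% h]
  simp

/-- This exhibits the composite as right multiplication by an element of Hom(1, A), to which
connectedness applies. -/
lemma comul_mul (hP : P.evaluation' = μ[A] ≫ t) :
    comul P ≫ μ[A] = (ρ_ A).inv ≫ A ◁ (P.coevaluation' ≫ μ[A]) ≫ μ[A] := by
  rw [comul_eq P hP, MonoidalCategory.whiskerLeft_comp]
  simp

end Frobenius

/-! ### Nondegeneracy of the trace form, and separability -/

section Nondegenerate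

variable {B : Type u} [Category.{v} B] [MonoidalCategory B] [Abelian B] [Linear ℂ B]
  [MonoidalPreadditive B] [MonoidalLinear ℂ B] [RigidCategory B] [IsFusionCategory B]
  [UnitaryStructure B] {A : B} [MonObj A]

/-- The trace of left multiplication. -/
noncomputable def mulTrace (S : StandardDual A) : A ⟶ 𝟙_ B :=
  (ρ_ A).inv ≫ A ◁ S.pairing.coevaluation' ≫ (α_ A A S.dual).inv ≫ μ[A] ▷ S.dual ≫
    dag S.pairing.coevaluation'

/-- The endomorphism of `Y ⊗ A` which multiplies by the values of `q` from the left. -/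
def leftMulBy {Y : B} (q : Y ⟶ Y ⊗ A) : Y ⊗ A ⟶ Y ⊗ A :=
  q ▷ A ≫ (α_ Y A A).hom ≫ Y ◁ μ[A]

/-- Closing the A-strand first turns the multiplication into the functional `mulTrace`. -/
lemma trace_leftMulBy (S : StandardDual A) {Y : B} (q : Y ⟶ Y ⊗ A) :
    trace (Y ⊗ A) (leftMulBy q) = trace Y (q ≫ Y ◁ mulTrace S ≫ (ρ_ Y).hom) := by
  rw [trace_tensor S]
  congr 1
  unfold rightPartialTrace leftMulBy mulTrace
  generalize S.pairing.coevaluation' = c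
  generalize dag c = c'
  calc _ = 𝟙 _ ⊗≫ (Y ◁ c ≫ q ▷ (A ⊗ S.dual)) ⊗≫ Y ◁ μ[A] ▷ S.dual ⊗≫ Y ◁ c' ⊗≫ 𝟙 _ := by
        monoidal
    _ = _ := by rw [whisker_exchange]; monoidal

lemma leftMulBy_comp {Y : B} (q q' : Y ⟶ Y ⊗ A) :
    leftMulBy q ≫ leftMulBy q' = leftMulBy (q ≫ leftMulBy q') := by
  unfold leftMulBy
  calc _ = 𝟙 _ ⊗≫ q ▷ A ⊗≫ (Y ◁ μ[A] ≫ q' ▷ A) ⊗≫ Y ◁ μ[A] ⊗≫ 𝟙 _ := by monoidal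
    _ = 𝟙 _ ⊗≫ q ▷ A ⊗≫ q' ▷ (A ⊗ A) ⊗≫ Y ◁ (A ◁ μ[A] ≫ μ[A]) ⊗≫ 𝟙 _ := by
      rw [whisker_exchange]; monoidal
    _ = _ := by rw [MonObj.mul_assoc_flip]; monoidal

lemma one_leftMulBy {Y : B} (q : Y ⟶ Y ⊗ A) : ((ρ_ Y).inv ≫ Y ◁ η[A]) ≫ leftMulBy q = q := by
  unfold leftMulBy
  rw [Category.assoc, whisker_exchange_assoc, ← rightUnitor_inv_naturality_assoc,
    associator_naturality_right_assoc, ← MonoidalCategory.whiskerLeft_comp, MonObj.mul_one]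
  monoidal

lemma leftMulBy_one {Y : B} : leftMulBy ((ρ_ Y).inv ≫ Y ◁ η[A]) = 𝟙 (Y ⊗ A) := by
  unfold leftMulBy
  have : Y ◁ η[A] ▷ A ≫ Y ◁ μ[A] = Y ◁ (λ_ A).hom := by
    rw [← MonoidalCategory.whiskerLeft_comp, MonObj.one_mul]
  simp [this]

lemma leftMulBy_pow {Y : B} (q : Y ⟶ Y ⊗ A) (Φ : End (Y ⊗ A)) (hΦ : Φ = leftMulBy q) (n : ℕ) :
    Φ ^ n = leftMulBy (((ρ_ Y).inv ≫ Y ◁ η[A]) ≫ Φ ^ n) := by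
  induction n with
  | zero =>
    rw [pow_zero]
    change 𝟙 _ = leftMulBy (_ ≫ 𝟙 _)
    rw [Category.comp_id, leftMulBy_one]
  | succ n ih =>
    rw [pow_succ]
    change Φ ≫ _ = leftMulBy (_ ≫ Φ ≫ _)
    rw [hΦ, ← Category.assoc _ (leftMulBy q), one_leftMulBy, ← hΦ]
    generalize Φ ^ n = Ψ at ih ⊢
    rw [ih, ← leftMulBy_comp, ← ih, hΦ]

variable {T : A ≅ A}

/-- The trace form of an algebra with a multiplicative positive functional is nondegenerate. -/
lemma eq_zero_of_mulTrace (S : StandardDual A)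
    (hT : ∀ F G : A ⟶ A, trace A (convolution A F G ≫ T.hom ≫ dag T.hom) =
      trace A (F ≫ T.hom ≫ dag T.hom) * trace A (G ≫ T.hom ≫ dag T.hom))
    {Y : B} (y : Y ⟶ A)
    (h : y ▷ A ≫ μ[A] ≫ mulTrace S = 0 ∨ A ◁ y ≫ μ[A] ≫ mulTrace S = 0) : y = 0 := by
  by_contra hy
  have hyT : y ≫ T.hom ≠ 0 := fun h0 => hy <| by
    rw [← Category.comp_id y, ← T.hom_inv_id, reassoc_of% h0, Limits.zero_comp]
  have hT0 : T.hom ≠ 0 := fun h0 => hyT (by rw [h0, Limits.comp_zero])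
  -- Φ inserts one more factor y y† under convolution: multiplying out the n-th power of Φ after the
  -- unit i gives id * (y y†) * ... * (y y†) with n such factors.
  obtain ⟨q, hq⟩ : ∃ q : A ⟶ A ⊗ A, q = dag μ[A] ≫ A ◁ (dag y ≫ y) := ⟨_, rfl⟩
  obtain ⟨Φ, hΦ⟩ : ∃ Φ : End (A ⊗ A), Φ = leftMulBy q := ⟨_, rfl⟩
  obtain ⟨i, hi⟩ : ∃ i : A ⟶ A ⊗ A, i = (ρ_ A).inv ≫ A ◁ η[A] := ⟨_, rfl⟩
  have hpow : ∀ n, Φ ^ n = leftMulBy (i ≫ Φ ^ n) := fun n => by rw [hi]; exact leftMulBy_pow q Φ hΦ n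
  have hiΦ : i ≫ Φ = q := by rw [hi, hΦ]; exact one_leftMulBy q
  have hsucc : ∀ n, i ≫ (Φ ^ (n + 1) : End (A ⊗ A)) = q ≫ (Φ ^ n : End (A ⊗ A)) := fun n => by
    rw [pow_succ]
    change i ≫ Φ ≫ _ = _
    rw [reassoc_of% hiΦ]
  have hsucc' : ∀ n, i ≫ (Φ ^ (n + 1) : End (A ⊗ A)) = (i ≫ (Φ ^ n : End (A ⊗ A))) ≫ Φ :=
    fun n => by
      rw [pow_succ', Category.assoc]
      rfl
  have htr : ∀ n : ℕ, trace (A ⊗ A) (Φ ^ (n + 1)) = 0 := by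
    intro n
    -- The trace of a positive power reduces to t applied to a product in which y is the leftmost
    -- factor (last Φ split off) or the rightmost (first Φ split off), matching the two cases of the
    -- hypothesis.
    have h0 : (i ≫ (Φ ^ (n + 1) : End (A ⊗ A))) ≫ A ◁ mulTrace S = 0 := by
      rcases h with h | h
      · have h' : (A ◁ y) ▷ A ≫ (α_ A A A).hom ≫ A ◁ μ[A] ≫ A ◁ mulTrace S = 0 := by
          rw [associator_naturality_middle_assoc, ← MonoidalCategory.whiskerLeft_comp,
            ← MonoidalCategory.whiskerLeft_comp, h]
          simp
        rw [hsucc']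
        generalize i ≫ Φ ^ n = r
        rw [hΦ, hq]
        unfold leftMulBy
        simp only [comp_whiskerRight, MonoidalCategory.whiskerLeft_comp, Category.assoc, h',
          Limits.comp_zero]
      · have h' : A ◁ y ≫ (i ≫ (Φ ^ n : End (A ⊗ A))) ▷ A ≫ (α_ A A A).hom ≫ A ◁ μ[A] ≫
            A ◁ mulTrace S = 0 := by
          rw [whisker_exchange_assoc, associator_naturality_right_assoc,
            ← MonoidalCategory.whiskerLeft_comp, ← MonoidalCategory.whiskerLeft_comp, h]
          simp
        rw [hsucc, hpow n, hq]
        unfold leftMulBy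
        simp only [MonoidalCategory.whiskerLeft_comp, Category.assoc] at h' ⊢
        rw [h']
        simp
    rw [hpow]
    refine (trace_leftMulBy S _).trans ?_
    rw [← Category.assoc (i ≫ _), h0]
    simp
  obtain ⟨n, hn⟩ := (isFaithfulPositive_trace (A ⊗ A)).exists_pow_eq_zero
    (fun x y => trace_comm (show A ⊗ A ⟶ A ⊗ A from y) (show A ⊗ A ⟶ A ⊗ A from x)) htr
  have hx : ∀ n : ℕ, trace A ((i ≫ (Φ ^ n : End (A ⊗ A)) ≫ μ[A]) ≫ T.hom ≫ dag T.hom) =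
      trace A (T.hom ≫ dag T.hom) * trace A ((dag y ≫ y) ≫ T.hom ≫ dag T.hom) ^ n := by
    intro n
    induction n with
    | zero =>
      have : i ≫ (Φ ^ 0 : End (A ⊗ A)) ≫ μ[A] = 𝟙 A := by
        rw [pow_zero]
        change i ≫ 𝟙 _ ≫ _ = _
        rw [hi]
        simp
      rw [this, Category.id_comp, pow_zero, mul_one]
    | succ n ih =>
      have : i ≫ (Φ ^ (n + 1) : End (A ⊗ A)) ≫ μ[A] =
          convolution A (i ≫ (Φ ^ n : End (A ⊗ A)) ≫ μ[A]) (dag y ≫ y) := by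
        have hp := hpow n
        rw [← Category.assoc, hsucc, convolution_apply, hq, tensorHom_def']
        generalize Φ ^ n = Ψ at hp ⊢
        have e : Ψ ≫ μ[A] = (i ≫ Ψ) ▷ A ≫ μ[A] ▷ A ≫ μ[A] := by
          nth_rewrite 1 [hp]
          unfold leftMulBy
          rw [Category.assoc, Category.assoc, MonObj.mul_assoc]
        simp only [Category.assoc, comp_whiskerRight] at e ⊢
        rw [e]
      rw [this, hT, ih, pow_succ, mul_assoc]
  have h1 := hx n
  rw [hn] at h1
  have h2 : i ≫ (0 : A ⊗ A ⟶ A ⊗ A) ≫ μ[A] = 0 := by simp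
  have h3 : (0 : ℂ) = trace A (T.hom ≫ dag T.hom) *
      trace A ((dag y ≫ y) ≫ T.hom ≫ dag T.hom) ^ n := by
    rw [← h1]
    change 0 = trace A ((i ≫ (0 : A ⊗ A ⟶ A ⊗ A) ≫ μ[A]) ≫ _)
    rw [h2]
    simp
  have h4 := trace_pos T.hom hT0
  have h5 : 0 < trace A ((dag y ≫ y) ≫ T.hom ≫ dag T.hom) := by
    have := trace_pos _ hyT
    rw [dag_comp, ← Category.assoc, trace_comm] at this
    simpa using this
  exact (mul_ne_zero h4.ne' (pow_ne_zero n h5.ne')) h3.symm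

theorem isSeparable_of_multiplicative (hA : IsConnectedAlgebra A)
    (hT : ∀ F G : A ⟶ A, trace A (convolution A F G ≫ T.hom ≫ dag T.hom) =
      trace A (F ≫ T.hom ≫ dag T.hom) * trace A (G ≫ T.hom ≫ dag T.hom)) :
    IsSeparableAlgebra A := by
  obtain ⟨S⟩ := nonempty_standardDual A
  let p := S.pairing
  obtain ⟨φ, hφ⟩ := exists_whiskerRight_evaluation p (μ[A] ≫ mulTrace S)
  have : Mono φ := Preadditive.mono_of_cancel_zero _ fun {Y} y hy => by
    refine eq_zero_of_mulTrace S hT y (Or.inl ?_)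
    rw [← hφ, ← comp_whiskerRight_assoc, hy]
    simp
  -- A morphism killed by φ is turned, through w w† and its mate k, into an endomorphism k of A in
  -- the other radical of the form.
  have : Epi φ := Preadditive.epi_of_cancel_zero _ fun {W} w hw => by
    refine dag_definite _ ?_
    obtain ⟨k, -, hk⟩ := exists_of_mate p p (w ≫ dag w)
    have hk0 : k = 0 := by
      refine eq_zero_of_mulTrace S hT k (Or.inr ?_)
      rw [← hφ, whisker_exchange_assoc, ← hk, ← comp_whiskerRight_assoc, reassoc_of% hw]
      simp
    apply whiskerRight_evaluation_injective p
    rw [hk, hk0]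
    simp
  have : IsIso φ := isIso_of_mono_of_epi φ
  let P : ExactPairing A A := exactPairingCongrRight (asIso φ)
  have hP : P.evaluation' = μ[A] ≫ mulTrace S := hφ
  have hη := one_ne_zero_of_connected hA
  obtain ⟨c, hc⟩ := exists_smul_one hA hη (P.coevaluation' ≫ μ[A])
  have hmul : comul P ≫ μ[A] = c • 𝟙 A := by
    rw [comul_mul P hP, ← hc]
    simp
  -- Tr(m Δ) = Tr(Δ m), and Δ m is `leftMulBy` of Δ, so its trace is that of (id ⊗ t) Δ = id by
  -- counitality.
  have htr : c * trace A (𝟙 A) = trace A (𝟙 A) := by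
    have h1 := trace_comm (comul P) μ[A]
    rw [hmul, ← comul_whiskerRight P] at h1
    rw [map_smul, smul_eq_mul] at h1
    rw [h1]
    refine (trace_leftMulBy S (comul P)).trans ?_
    rw [comul_counit P hP]
  have hid : trace A (𝟙 A) ≠ 0 := by
    have h := trace_pos (𝟙 A) fun h0 => hη (by rw [← Category.comp_id η[A], h0, Limits.comp_zero])
    rw [dag_id, Category.comp_id] at h
    exact h.ne'
  have hc1 : c = 1 := mul_right_cancel₀ hid (by rw [htr, one_mul])
  exact ⟨comul P, by rw [hmul, hc1, one_smul], whiskerLeft_comul P hP, comul_whiskerRight P⟩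

end Nondegenerate

end UnitaryFusion

theorem mainTheorem4 {B : Type u} [Category.{v} B] [MonoidalCategory B] [Abelian B] [Linear ℂ B]
    [MonoidalPreadditive B] [MonoidalLinear ℂ B] [RigidCategory B]
    [IsFusionCategory B] [UnitaryStructure B]
    (A : B) [MonObj A] (hA : UnitaryFusion.IsConnectedAlgebra A) :
    UnitaryFusion.IsSeparableAlgebra A ↔
      ∃ T : A ≅ A, ∀ a b : B,
        UnitaryFusion.IsPartialIsometry
          (UnitaryFusion.tensorForm (UnitaryFusion.homForm T a) (UnitaryFusion.homForm T b))
          (UnitaryFusion.homForm T (a ⊗ b))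
          (UnitaryFusion.mulHom A a b) ∧
        Function.Injective (UnitaryFusion.mulHom A a b) := by
  constructor
  · intro hs
    obtain ⟨T, hT⟩ := UnitaryFusion.exists_iso_of_isSeparable hA hs
    exact ⟨T, UnitaryFusion.isPartialIsometry_mulHom T hT⟩
  · rintro ⟨T, hT⟩
    refine UnitaryFusion.isSeparable_of_multiplicative (T := T) hA fun F G => ?_
    obtain ⟨h1, h2⟩ := hT A A
    have hker : ∀ x k, UnitaryFusion.mulHom A A A k = 0 →
        UnitaryFusion.tensorForm (UnitaryFusion.homForm T A) (UnitaryFusion.homForm T A) k x = 0 :=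
      fun x k hk => by
        rw [(injective_iff_map_eq_zero _).1 h2 k hk, map_zero, LinearMap.zero_apply]
    -- Injectivity makes the orthogonality conditions vacuous, and pairing with id ⊗ id turns
    -- isometry into multiplicativity.
    have h3 := h1 (𝟙 A ⊗ₜ 𝟙 A) (F ⊗ₜ G) (hker _) (hker _)
    rw [UnitaryFusion.homForm_mulHom, UnitaryFusion.tensorForm_tmul, UnitaryFusion.homForm_eq,
      UnitaryFusion.homForm_eq, UnitaryFusion.dag_id, Category.id_comp, Category.id_comp] at h3
    exact h3
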